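/- **Theorem 3.1.** Let $p,q\ge 0$ and let $w(s,t)=p$ if $0<s<t$, $w(s,t)=q$ if $0<t<s$, and $w(s,t)=1$ otherwise. On the free Fock space $\mathcal F=\mathbb C\Omega\oplus\bigoplus_{n\ge1}L^2(\mathbb R_+^n)$ over $L^2(\mathbb R_+)$ let, for $f\in L^2(\mathbb R_+)$, $a(f)$ be the bounded operator with $a(f)\Omega=f$ and $$(a(f)F)(t,t_1,\dots,t_n)=f(t)\sqrt{w(t,t_1)}\,F(t_1,\dots,t_n)\qquad(F\in L^2(\mathbb R_+^n),\ n\ge1),$$ let $a^*(f)$ be its adjoint, $\omega(f)=a(f)+a^*(f)$, and $\varphi(T)=\langle T\Omega,\Omega\rangle$. An *ordered non-crossing pair partition* of $[n]=\{1,\dots,n\}$ is a sequence $P=(P_1,\dots,P_m)$ of pairwise disjoint two-element blocks with union $[n]$, no two of which cross; their set is denoted $\mathcal{ONC}^2_n$ (it is empty for odd $n$). A block $P_j$ is *outer* to $P_i$, $i\neq j$, if there are $a,b\in P_j$ with $a<c<b$ for all $c\in P_i$; it is the *neighboring* outer block if moreover no block is both inner to $P_j$ and outer to $P_i$. Let $e(P)$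 (respectively $e'(P)$) be the number of pairs $i<j$ such that $P_j$ is the neighboring outer block of $P_i$ (respectively $P_i$ is the neighboring outer block of $P_j$), and put $w(P)=p^{e(P)}q^{e'(P)}$, where $0^0=1$. Let $n\ge0$ and let $f_1,\dots,f_n$ be characteristic functions of intervals $[s,t]$ with $0\le s<t<\infty$, any two of which are identical or disjoint, where disjoint intervals are allowed to have a common endpoint. For two such functions write $\chi_I\le\chi_J$ if $I=J$ or $\sup I\le\inf J$. Call $P\in\mathcal{ONC}^2_n$ *adapted* to $(f_1,\dots,f_n)$, written $P\sim(f_1,\dots,f_n)$, if $f_i=f_j$ whenever $i,j$ lie in the same block, and $f_i\le f_j$ whenever $i\in P_k$, $j\in P_l$ and $k<l$. Let $I_1,\dots,I_r$ be the distinct intervals among those of $f_1,\dots,f_n$, let $b_i=\tfrac12|\{j: f_j=\chi_{I_i}\}|$, and let $\lambda$ be Lebesgue measure. Then $$\varphi(\omega(f_1)\omega(f_2)\cdots\omega(f_n))=\prod_{i=1}^r\frac{\lambda(I_i)^{b_i}}{b_i!}\sum_{\substack{P\in\mathcal{ONC}^2_{n}\\ P\sim(f_1,\dots,f_n)}}w(P).$$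 If some $b_i$ is not an integer, the sum on the right is empty and the right-hand side is read as $0$. In particular, with $\omega_t=\omega(\chi_{[0,t]})$, for all $n\ge0$ and $t\ge0$, $$\varphi(\omega_t^{2n})=\sum_{P\in\mathcal{ONC}^2_{2n}}w(P)\,\frac{t^n}{n!}.$$ -/

import Mathlib

open MeasureTheory

namespace PQ

noncomputable section

/-! ## The free Fock space over `L²(ℝ₊)` -/

/-- Lebesgue measure on the half-line `ℝ₊ = [0, ∞)`. -/
def halfLine : Measure ℝ := volume.restrict (Set.Ici 0)

instance : SigmaFinite halfLine := by unfold halfLine; infer_instance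

/-- Lebesgue measure on `ℝ₊ⁿ`; for `n = 0` it is the unit mass on a one-point space. -/
def orthant (n : ℕ) : Measure (Fin n → ℝ) := Measure.pi fun _ => halfLine

/-- The one-particle space `L²(ℝ₊)`. -/
abbrev H : Type := Lp ℂ 2 halfLine

/-- The `n`-particle space `L²(ℝ₊)^{⊗n} ≅ L²(ℝ₊ⁿ)`; for `n = 0` it is a copy of `ℂ`. -/
abbrev Particle (n : ℕ) : Type := Lp ℂ 2 (orthant n)

/-- The free Fock space `ℂΩ ⊕ ⨁_{n ≥ 1} L²(ℝ₊ⁿ)` (Hilbert space direct sum). -/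
abbrev Fock : Type := lp Particle 2

theorem memLp_one_zero : MemLp (fun _ : Fin 0 → ℝ => (1 : ℂ)) 2 (orthant 0) := by
  unfold orthant
  rw [Measure.pi_of_empty (fun _ : Fin 0 => halfLine)]
  exact memLp_const 1

/-- The vacuum vector `Ω`: the constant function `1` on `ℝ₊⁰` in degree `0`. -/
def vacuum : Fock := lp.single 2 0 (memLp_one_zero.toLp _)

/-- The vacuum state `φ(T) = ⟨TΩ, Ω⟩` (Mathlib's inner product is linear in its second
argument). -/
def vacuumState (T : Fock →L[ℂ] Fock) : ℂ := inner ℂ vacuum (T vacuum)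

/-! ## The weight and the creation operators -/

/-- The weight function on `ℝ₊ × ℝ₊`. -/
def weight (p q s t : ℝ) : ℝ :=
  if 0 < s ∧ s < t then p else if 0 < t ∧ t < s then q else 1

/-- `√w(s, x₁)` for a point `x = (x₁, …, xₙ)`, read as `1` when `n = 0`. -/
def coupling (p q s : ℝ) : {n : ℕ} → (Fin n → ℝ) → ℝ
  | 0, _ => 1
  | _ + 1, x => √(weight p q s (x 0))

/-- A bound for the coupling. -/
def bound (p q : ℝ) : ℝ := 1 + √p + √q

/-- The function `(t, t₁, …, tₙ) ↦ f(t) √w(t, t₁) F(t₁, …, tₙ)`. -/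
def createFun (p q : ℝ) (f : ℝ → ℂ) {n : ℕ} (F : (Fin n → ℝ) → ℂ) (x : Fin (n + 1) → ℝ) : ℂ :=
  f (x 0) * (coupling p q (x 0) (Fin.tail x) : ℂ) * F (Fin.tail x)

theorem bound_nonneg (p q : ℝ) : 0 ≤ bound p q := by unfold bound; positivity

theorem measurable_weight (p q : ℝ) : Measurable fun z : ℝ × ℝ => weight p q z.1 z.2 := by
  unfold weight
  refine Measurable.ite ?_ measurable_const (Measurable.ite ?_ measurable_const measurable_const)
  · exact (measurableSet_lt measurable_const measurable_fst).inter
      (measurableSet_lt measurable_fst measurable_snd)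
  · exact (measurableSet_lt measurable_const measurable_snd).inter
      (measurableSet_lt measurable_snd measurable_fst)

theorem measurable_coupling (p q : ℝ) (n : ℕ) :
    Measurable fun z : ℝ × (Fin n → ℝ) => coupling p q z.1 z.2 := by
  cases n with
  | zero => exact measurable_const
  | succ n =>
    have h : Measurable fun z : ℝ × (Fin (n + 1) → ℝ) => (z.1, z.2 0) := by fun_prop
    exact ((measurable_weight p q).comp h).sqrt

theorem norm_coupling_le (p q s : ℝ) {n : ℕ} (x : Fin n → ℝ) :
    ‖(coupling p q s x : ℂ)‖ ≤ bound p q := by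
  have hp := Real.sqrt_nonneg p
  have hq := Real.sqrt_nonneg q
  rw [Complex.norm_real, Real.norm_eq_abs]
  cases n with
  | zero => simp only [coupling, bound, abs_one]; linarith
  | succ n =>
    simp only [coupling, bound, weight]
    rw [abs_of_nonneg (Real.sqrt_nonneg _)]
    split_ifs
    · linarith
    · linarith
    · rw [Real.sqrt_one]; linarith

theorem measurePreserving_split (n : ℕ) :
    MeasurePreserving (fun x : Fin (n + 1) → ℝ => (x 0, Fin.tail x)) (orthant (n + 1))
      (halfLine.prod (orthant n)) :=
  measurePreserving_piFinSuccAbove (fun _ : Fin (n + 1) => halfLine) 0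

instance (n : ℕ) : SigmaFinite (orthant n) := by unfold orthant; infer_instance

theorem eLpNorm_mul_prod (n : ℕ) {f : ℝ → ℂ} {F : (Fin n → ℝ) → ℂ}
    (hf : AEStronglyMeasurable f halfLine) (hF : AEStronglyMeasurable F (orthant n)) :
    eLpNorm (fun z : ℝ × (Fin n → ℝ) => f z.1 * F z.2) 2 (halfLine.prod (orthant n)) =
      eLpNorm f 2 halfLine * eLpNorm F 2 (orthant n) := by
  have h2 : (2 : ENNReal) ≠ 0 := by norm_num
  have h2' : (2 : ENNReal) ≠ ⊤ := by norm_num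
  simp only [eLpNorm_eq_lintegral_rpow_enorm_toReal h2 h2', enorm_mul]
  rw [← ENNReal.mul_rpow_of_nonneg _ _ (by norm_num), ← lintegral_prod_mul]
  · simp only [ENNReal.toReal_ofNat, ENNReal.mul_rpow_of_nonneg _ _ (zero_le_two : (0:ℝ) ≤ 2)]
  · exact hf.enorm.pow_const _
  · exact hF.enorm.pow_const _

theorem aestronglyMeasurable_createFun (p q : ℝ) {n : ℕ} {f : ℝ → ℂ} {F : (Fin n → ℝ) → ℂ}
    (hf : AEStronglyMeasurable f halfLine) (hF : AEStronglyMeasurable F (orthant n)) :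
    AEStronglyMeasurable (createFun p q f F) (orthant (n + 1)) := by
  have h : AEStronglyMeasurable
      (fun z : ℝ × (Fin n → ℝ) => f z.1 * (coupling p q z.1 z.2 : ℂ) * F z.2)
      (halfLine.prod (orthant n)) :=
    (hf.comp_fst.mul (Complex.measurable_ofReal.comp
      (measurable_coupling p q n)).aestronglyMeasurable).mul hF.comp_snd
  exact h.comp_measurePreserving (measurePreserving_split n)

theorem eLpNorm_createFun_le (p q : ℝ) {n : ℕ} {f : ℝ → ℂ} {F : (Fin n → ℝ) → ℂ}
    (hf : AEStronglyMeasurable f halfLine) (hF : AEStronglyMeasurable F (orthant n)) :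
    eLpNorm (createFun p q f F) 2 (orthant (n + 1)) ≤
      ENNReal.ofReal (bound p q) * (eLpNorm f 2 halfLine * eLpNorm F 2 (orthant n)) := by
  have hm : AEStronglyMeasurable (fun z : ℝ × (Fin n → ℝ) => f z.1 * F z.2)
      (halfLine.prod (orthant n)) := hf.comp_fst.mul hF.comp_snd
  rw [← eLpNorm_mul_prod n hf hF,
    ← eLpNorm_comp_measurePreserving hm (measurePreserving_split n)]
  refine eLpNorm_le_mul_eLpNorm_of_ae_le_mul (Filter.Eventually.of_forall fun x => ?_) 2
  simp only [createFun, Function.comp, norm_mul]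
  have h := norm_coupling_le p q (x 0) (Fin.tail x)
  calc ‖f (x 0)‖ * ‖(coupling p q (x 0) (Fin.tail x) : ℂ)‖ * ‖F (Fin.tail x)‖
      = ‖(coupling p q (x 0) (Fin.tail x) : ℂ)‖ * (‖f (x 0)‖ * ‖F (Fin.tail x)‖) := by ring
    _ ≤ _ := by gcongr

theorem memLp_createFun (p q : ℝ) (f : H) {n : ℕ} (F : Particle n) :
    MemLp (createFun p q f F) 2 (orthant (n + 1)) :=
  ⟨aestronglyMeasurable_createFun p q (Lp.aestronglyMeasurable f) (Lp.aestronglyMeasurable F),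
    (eLpNorm_createFun_le p q (Lp.aestronglyMeasurable f) (Lp.aestronglyMeasurable F)).trans_lt
      (ENNReal.mul_lt_top ENNReal.ofReal_lt_top
        (ENNReal.mul_lt_top (Lp.eLpNorm_lt_top f) (Lp.eLpNorm_lt_top F)))⟩

/-- Creation on the `n`-particle space. -/
def createParticle (p q : ℝ) (f : H) {n : ℕ} (F : Particle n) : Particle (n + 1) :=
  (memLp_createFun p q f F).toLp _

theorem createParticle_coeFn (p q : ℝ) (f : H) {n : ℕ} (F : Particle n) :
    createParticle p q f F =ᵐ[orthant (n + 1)] createFun p q f F :=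
  MemLp.coeFn_toLp _

theorem ae_tail {n : ℕ} {P : (Fin n → ℝ) → Prop} (h : ∀ᵐ y ∂orthant n, P y) :
    ∀ᵐ x ∂orthant (n + 1), P (Fin.tail x) :=
  (Measure.quasiMeasurePreserving_snd.comp
    (measurePreserving_split n).quasiMeasurePreserving).ae h

theorem createParticle_add (p q : ℝ) (f : H) {n : ℕ} (F G : Particle n) :
    createParticle p q f (F + G) = createParticle p q f F + createParticle p q f G := by
  apply Lp.ext
  filter_upwards [createParticle_coeFn p q f (F + G), createParticle_coeFn p q f F,
    createParticle_coeFn p q f G, Lp.coeFn_add (createParticle p q f F) (createParticle p q f G),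
    ae_tail (Lp.coeFn_add F G)] with x h1 h2 h3 h4 h5
  rw [h1, h4, Pi.add_apply, h2, h3, createFun, h5, Pi.add_apply, createFun, createFun, mul_add]

theorem createParticle_smul (p q : ℝ) (f : H) {n : ℕ} (c : ℂ) (F : Particle n) :
    createParticle p q f (c • F) = c • createParticle p q f F := by
  apply Lp.ext
  filter_upwards [createParticle_coeFn p q f (c • F), createParticle_coeFn p q f F,
    Lp.coeFn_smul c (createParticle p q f F), ae_tail (Lp.coeFn_smul c F)] with x h1 h2 h3 h4
  rw [h1, h3, Pi.smul_apply, h2, createFun, h4, Pi.smul_apply, createFun, smul_eq_mul, smul_eq_mul]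
  ring

theorem norm_createParticle_le (p q : ℝ) (f : H) {n : ℕ} (F : Particle n) :
    ‖createParticle p q f F‖ ≤ bound p q * ‖f‖ * ‖F‖ := by
  have h := eLpNorm_createFun_le p q (Lp.aestronglyMeasurable f) (Lp.aestronglyMeasurable F)
  rw [createParticle, Lp.norm_toLp, Lp.norm_def, Lp.norm_def]
  have h' := ENNReal.toReal_mono (ENNReal.mul_lt_top ENNReal.ofReal_lt_top
    (ENNReal.mul_lt_top (Lp.eLpNorm_lt_top f) (Lp.eLpNorm_lt_top F))).ne h
  rwa [ENNReal.toReal_mul, ENNReal.toReal_mul, ENNReal.toReal_ofReal (bound_nonneg p q),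
    ← mul_assoc] at h'

/-- The components of the image of a Fock vector under creation. -/
def createSeq (p q : ℝ) (f : H) (F : Fock) : (n : ℕ) → Particle n
  | 0 => 0
  | n + 1 => createParticle p q f (F n)

theorem createSeq_sum_le (p q : ℝ) (f : H) (F : Fock) (s : Finset ℕ) :
    ∑ n ∈ s, ‖createSeq p q f F n‖ ^ (2 : ENNReal).toReal ≤
      (bound p q * ‖f‖ * ‖F‖) ^ (2 : ENNReal).toReal := by
  have h2 : 0 < (2 : ENNReal).toReal := by norm_num
  have hK : 0 ≤ bound p q * ‖f‖ := mul_nonneg (bound_nonneg p q) (norm_nonneg _)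
  have hs : s ⊆ Finset.range (s.sup id + 1 + 1) := fun i hi =>
    Finset.mem_range.2 (by have := Finset.le_sup (f := id) hi; simp only [id] at this; omega)
  refine (Finset.sum_le_sum_of_subset_of_nonneg hs
    (fun _ _ _ => Real.rpow_nonneg (norm_nonneg _) _)).trans ?_
  rw [Finset.sum_range_succ', Real.mul_rpow hK (norm_nonneg _)]
  have h0 : ‖createSeq p q f F 0‖ ^ (2 : ENNReal).toReal = 0 := by
    simp [createSeq]
  rw [h0, add_zero]
  calc ∑ n ∈ Finset.range (s.sup id + 1), ‖createSeq p q f F (n + 1)‖ ^ (2 : ENNReal).toReal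
      ≤ ∑ n ∈ Finset.range (s.sup id + 1),
          (bound p q * ‖f‖) ^ (2 : ENNReal).toReal * ‖F n‖ ^ (2 : ENNReal).toReal := by
        refine Finset.sum_le_sum fun n _ => ?_
        rw [← Real.mul_rpow hK (norm_nonneg _)]
        exact Real.rpow_le_rpow (norm_nonneg _) (norm_createParticle_le p q f (F n)) h2.le
    _ ≤ _ := by
        rw [← Finset.mul_sum]
        exact mul_le_mul_of_nonneg_left (lp.sum_rpow_le_norm_rpow h2 F _) (Real.rpow_nonneg hK _)

/-- The `(p,q)`-creation operator `a(f)`, the bounded operator on the free Fock space which maps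
`F ∈ L²(ℝ₊ⁿ)` to the function `(t, t₁, …, tₙ) ↦ f(t) √w(t, t₁) F(t₁, …, tₙ)` for `n ≥ 1` and `Ω`
to `f`. In particular it maps the product
`(f₁ ⊛ ⋯ ⊛ fₙ)(t₁, …, tₙ) = f₁(t₁) √w(t₁, t₂) f₂(t₂) ⋯ √w(tₙ₋₁, tₙ) fₙ(tₙ)`
to `f ⊛ f₁ ⊛ ⋯ ⊛ fₙ`. -/
def creation (p q : ℝ) (f : H) : Fock →L[ℂ] Fock :=
  LinearMap.mkContinuous
    { toFun := fun F => ⟨createSeq p q f F, memℓp_gen' (createSeq_sum_le p q f F)⟩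
      map_add' := fun F G => by
        apply lp.ext
        funext n
        cases n with
        | zero => exact (add_zero _).symm
        | succ n => exact createParticle_add p q f (F n) (G n)
      map_smul' := fun c F => by
        apply lp.ext
        funext n
        cases n with
        | zero => exact (smul_zero (A := Particle 0) c).symm
        | succ n => exact createParticle_smul p q f c (F n) }
    (bound p q * ‖f‖)
    (fun F => lp.norm_le_of_forall_sum_le (by norm_num)
      (mul_nonneg (mul_nonneg (bound_nonneg p q) (norm_nonneg _)) (norm_nonneg _))
      (createSeq_sum_le p q f F))

theorem creation_apply_zero (p q : ℝ) (f : H) (F : Fock) : creation p q f F 0 = 0 := rfl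

theorem creation_apply_succ (p q : ℝ) (f : H) (F : Fock) (n : ℕ) :
    creation p q f F (n + 1) = createParticle p q f (F n) := rfl

/-- The `(p,q)`-annihilation operator `a*(f)`, the adjoint of `a(f)`. -/
def annihilation (p q : ℝ) (f : H) : Fock →L[ℂ] Fock :=
  ContinuousLinearMap.adjoint (creation p q f)

/-- The `(p,q)`-Gaussian operator `ω(f) = a(f) + a*(f)`. -/
def gaussian (p q : ℝ) (f : H) : Fock →L[ℂ] Fock :=
  creation p q f + annihilation p q f

/-! ## Intervals -/

theorem halfLine_Icc_ne_top (s t : ℝ) : halfLine (Set.Icc s t) ≠ ⊤ :=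
  ((Measure.restrict_apply_le _ _).trans_lt measure_Icc_lt_top).ne

/-- The characteristic function `χ_{[s,t]}` as an element of `L²(ℝ₊)`. -/
def chi (s t : ℝ) : H :=
  indicatorConstLp 2 (measurableSet_Icc (a := s) (b := t)) (halfLine_Icc_ne_top s t) 1

/-- An interval `[lo, hi]` with `0 ≤ lo < hi < ∞`. -/
@[ext] structure Interval where
  lo : ℝ
  hi : ℝ
  lo_nonneg : 0 ≤ lo
  lo_lt_hi : lo < hi

namespace Interval

/-- The characteristic function of an interval. -/
def chi (I : Interval) : H := PQ.chi I.lo I.hi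

/-- The Lebesgue measure `λ(I)`. -/
def length (I : Interval) : ℝ := I.hi - I.lo

/-- `I < J`: the interval `I` lies to the left of `J` (a common endpoint is allowed). -/
def Before (I J : Interval) : Prop := I.hi ≤ J.lo

/-- `I ≤ J`: `I` lies to the left of `J` or `I = J`. -/
def BeforeOrEq (I J : Interval) : Prop := I.Before J ∨ I = J

/-- The two intervals are disjoint, except possibly for a common endpoint. -/
def Apart (I J : Interval) : Prop := I.Before J ∨ J.Before I

end Interval

/-! ## Ordered non-crossing pair partitions -/

section Partitions

variable {n k : ℕ}

/-- `P = (P₁, …, Pₖ)` is an ordered partition of an `n`-element linearly ordered set: the blocks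
are nonempty, pairwise disjoint and cover the set. -/
def IsOrderedPartition (P : Fin k → Finset (Fin n)) : Prop :=
  (∀ i, (P i).Nonempty) ∧ (∀ i j, i ≠ j → Disjoint (P i) (P j)) ∧ ∀ a, ∃ i, a ∈ P i

/-- All blocks have two elements. -/
def IsPair (P : Fin k → Finset (Fin n)) : Prop := ∀ i, (P i).card = 2

/-- No two different blocks cross. -/
def IsNonCrossing (P : Fin k → Finset (Fin n)) : Prop :=
  ∀ i j, i ≠ j → ¬ ∃ a ∈ P i, ∃ a' ∈ P i, ∃ b ∈ P j, ∃ b' ∈ P j, a < b ∧ b < a' ∧ a' < b'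

/-- `Pⱼ` is outer with respect to `Pᵢ` (and `Pᵢ` is inner with respect to `Pⱼ`), the strict
partial order `Pⱼ < Pᵢ` on blocks. -/
def IsOuter (P : Fin k → Finset (Fin n)) (j i : Fin k) : Prop :=
  j ≠ i ∧ ∃ a ∈ P j, ∃ b ∈ P j, ∀ c ∈ P i, a < c ∧ c < b

/-- `Pⱼ` is the neighboring outer block of `Pᵢ`: it is outer with respect to `Pᵢ`, and there is
no block strictly in between. -/
def IsNeighborOuter (P : Fin k → Finset (Fin n)) (j i : Fin k) : Prop :=
  IsOuter P j i ∧ ∀ l, ¬ (IsOuter P j l ∧ IsOuter P l i)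

open Classical in
/-- `e(P)`, the number of disorders: pairs `i < j` such that `Pⱼ` is the neighboring outer block
of `Pᵢ`. -/
def disorders (P : Fin k → Finset (Fin n)) : ℕ :=
  (Finset.univ.filter fun x : Fin k × Fin k => x.1 < x.2 ∧ IsNeighborOuter P x.2 x.1).card

open Classical in
/-- `e'(P)`, the number of orders: pairs `i < j` such that `Pᵢ` is the neighboring outer block
of `Pⱼ`. -/
def orders (P : Fin k → Finset (Fin n)) : ℕ :=
  (Finset.univ.filter fun x : Fin k × Fin k => x.1 < x.2 ∧ IsNeighborOuter P x.1 x.2).card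

/-- The weight `w(P) = p^{e(P)} q^{e'(P)}`. -/
def partitionWeight (p q : ℝ) (P : Fin k → Finset (Fin n)) : ℝ :=
  p ^ disorders P * q ^ orders P

/-- `P` is adapted to the characteristic functions of the intervals `I₁, …, Iₙ`: these are equal
within each block, and weakly increasing along the order of the blocks. -/
def IsAdapted (P : Fin k → Finset (Fin n)) (I : Fin n → Interval) : Prop :=
  (∀ l, ∀ i ∈ P l, ∀ j ∈ P l, I i = I j) ∧
    ∀ l m, l < m → ∀ i ∈ P l, ∀ j ∈ P m, (I i).BeforeOrEq (I j)

variable (n) in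
open Classical in
/-- The set of ordered non-crossing pair partitions of an `n`-element linearly ordered set. Such a
partition has `n / 2` blocks; there is none when `n` is odd. -/
def ONC2 : Finset (Fin (n / 2) → Finset (Fin n)) :=
  Finset.univ.filter fun P => IsOrderedPartition P ∧ IsPair P ∧ IsNonCrossing P

open Classical in
/-- Half the number of indices `j` with `Iⱼ = J`. The rounding down plays no role when some pair
partition is adapted to the `Iⱼ`, since then these numbers are even. -/
def halfCount (I : Fin n → Interval) (J : Interval) : ℕ :=
  (Finset.univ.filter fun j => I j = J).card / 2

end Partitions

end

end PQ

/-!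
The argument turns the vacuum expectation into an integral over point configurations, whose
increasing part is the sum over ordered partitions.

A word in the operators `ω(f)` is moved to the left argument of the inner product, where its
letters act in turn on product vectors `h₁ ⊛ ⋯ ⊛ hₘ = a(h₁) ⋯ a(hₘ) Ω`. Creation pushes a factor.
Annihilation removes the first factor `h₁` and multiplies the second one by
`s ↦ ∫ f(t) h₁(t) w(t, s) dt` (`annihilation_creation_creation`), so it leads to a product vector
again. Hence the expectation obeys a recursion over stacks of functions (`pairing`,
`inner_productVector`).

Giving each of the `k = n / 2` creations a label `l` and an integration variable `t_l` unfolds this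
recursion: by Tonelli, `k!` times the expectation is the integral over `ℝ₊ᵏ` of a function
(`labelled`) which sums over all labellings of the creations (`factorial_mul_pairing`). This
function is symmetric in the coordinates, and almost every configuration has exactly one increasing
rearrangement, so the factor `k!` disappears when the integral is restricted to increasing
configurations (`pairing_nil_eq_lintegral`).

At a fixed configuration the integrand is a sum over the labellings of the letters by
`{1, …, k}`. A labelling survives the stack recursion exactly if it describes a non-crossing pair
partition, and it then yields the product of `w(t_l, t_m)` over all blocks `l` with neighboring
outer block `m` (`run_eq`). On increasing configurations this is `p^{e(P)} q^{e'(P)}`, where `P` is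
the partition ordered by its labels.

What remains is the volume of the increasing configurations with `t_l` in the interval of the block
`P_l`. It is zero unless `P` is adapted (`volume_admissible`). If `P` is adapted, the whole box
splits into the images of this set under the permutations that preserve the sides, and there are
`∏ bᵢ!` of them (`volume_box_strictMono`).
-/

namespace PQ

noncomputable section

open scoped NNReal ENNReal

/-! ### Annihilation on product vectors -/

theorem weight_nonneg {p q : ℝ} (hp : 0 ≤ p) (hq : 0 ≤ q) (s t : ℝ) : 0 ≤ weight p q s t := by
  unfold weight
  split_ifs <;> first | assumption | exact zero_le_one

theorem weight_le {p q : ℝ} (hp : 0 ≤ p) (hq : 0 ≤ q) (s t : ℝ) :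
    weight p q s t ≤ 1 + p + q := by
  unfold weight
  split_ifs <;> linarith

/-- A nonnegative function in `L²(ℝ₊)`, as an honest function rather than a class modulo
null sets. -/
structure Profile where
  fn : ℝ → ℝ≥0
  measurable : Measurable fn
  memLp : MemLp (fun t => ((fn t : ℝ) : ℂ)) 2 halfLine

namespace Profile

/-- The element of `L²(ℝ₊)` represented by a profile. -/
def toH (f : Profile) : H := f.memLp.toLp _

theorem toH_coeFn (f : Profile) : f.toH =ᵐ[halfLine] fun t => ((f.fn t : ℝ) : ℂ) :=
  MemLp.coeFn_toLp _

/-- The pairing `∫ f h` of two profiles. -/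
def overlap (f h : Profile) : ℝ≥0 := (∫⁻ t, f.fn t * h.fn t ∂halfLine).toNNReal

/-- The function `s ↦ ∫ f(t) h(t) w(t, s) dt`. -/
def kernel (p q : ℝ) (f h : Profile) (s : ℝ) : ℝ≥0 :=
  (∫⁻ t, f.fn t * h.fn t * ENNReal.ofReal (weight p q t s) ∂halfLine).toNNReal

theorem lintegral_mul_ne_top (f h : Profile) : ∫⁻ t, f.fn t * h.fn t ∂halfLine ≠ ⊤ := by
  have h1 : MemLp ((fun t => ((f.fn t : ℝ) : ℂ)) * fun t => ((h.fn t : ℝ) : ℂ)) 1 halfLine :=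
    h.memLp.mul f.memLp
  have h2 := (memLp_one_iff_integrable.1 h1).hasFiniteIntegral
  refine (lt_of_eq_of_lt ?_ h2).ne
  refine lintegral_congr fun t => ?_
  rw [Pi.mul_apply, enorm_mul]
  simp [← ofReal_norm]

theorem coe_overlap (f h : Profile) :
    (f.overlap h : ℝ≥0∞) = ∫⁻ t, f.fn t * h.fn t ∂halfLine :=
  ENNReal.coe_toNNReal (lintegral_mul_ne_top f h)

theorem lintegral_kernel_le {p q : ℝ} (hp : 0 ≤ p) (hq : 0 ≤ q) (f h : Profile) (s : ℝ) :
    ∫⁻ t, f.fn t * h.fn t * ENNReal.ofReal (weight p q t s) ∂halfLine ≤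
      f.overlap h * ENNReal.ofReal (1 + p + q) := by
  rw [coe_overlap, ← lintegral_mul_const']
  · exact lintegral_mono fun t => by gcongr; exact weight_le hp hq t s
  · exact ENNReal.ofReal_ne_top

theorem coe_kernel {p q : ℝ} (hp : 0 ≤ p) (hq : 0 ≤ q) (f h : Profile) (s : ℝ) :
    (kernel p q f h s : ℝ≥0∞) =
      ∫⁻ t, f.fn t * h.fn t * ENNReal.ofReal (weight p q t s) ∂halfLine :=
  ENNReal.coe_toNNReal ((lintegral_kernel_le hp hq f h s).trans_lt
    (ENNReal.mul_lt_top ENNReal.coe_lt_top ENNReal.ofReal_lt_top)).ne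

theorem measurable_kernel (p q : ℝ) (f h : Profile) : Measurable (kernel p q f h) := by
  have hf := f.measurable
  have hh := h.measurable
  have hw := measurable_weight p q
  refine Measurable.ennreal_toNNReal (Measurable.lintegral_prod_left'
    (f := fun z : ℝ × ℝ => (f.fn z.1 : ℝ≥0∞) * h.fn z.1 * ENNReal.ofReal (weight p q z.1 z.2)) ?_)
  fun_prop

/-- The profile `g · ∫ f(t) h(t) w(t, ·) dt`. -/
def contract (p q : ℝ) (hp : 0 ≤ p) (hq : 0 ≤ q) (f h g : Profile) : Profile where
  fn s := g.fn s * kernel p q f h s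
  measurable := g.measurable.mul (measurable_kernel p q f h)
  memLp := by
    refine MemLp.of_le_mul (c := f.overlap h * (1 + p + q)) g.memLp ?_
      (Filter.Eventually.of_forall fun s => ?_)
    · have := g.measurable.mul (measurable_kernel p q f h)
      exact (Complex.measurable_ofReal.comp
        (measurable_coe_nnreal_real.comp this)).aestronglyMeasurable
    · have h1 := lintegral_kernel_le hp hq f h s
      rw [← coe_kernel hp hq, ENNReal.ofReal, ← ENNReal.coe_mul, ENNReal.coe_le_coe,
        ← NNReal.coe_le_coe, NNReal.coe_mul, Real.coe_toNNReal _ (by positivity)] at h1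
      simp only [Complex.norm_real, NNReal.coe_mul, norm_mul, Real.norm_eq_abs, NNReal.abs_eq]
      rw [mul_comm]
      gcongr

end Profile

theorem ae_head {n : ℕ} {P : ℝ → Prop} (h : ∀ᵐ y ∂halfLine, P y) :
    ∀ᵐ x ∂orthant (n + 1), P (x 0) :=
  (Measure.quasiMeasurePreserving_fst.comp
    (measurePreserving_split n).quasiMeasurePreserving).ae h

/-- The inner product of two created vectors, with the new variable integrated first: the two
factors `√w` combine to a square. -/
theorem inner_createParticle (p q : ℝ) (f h : Profile) {n : ℕ} (G E : Particle n) :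
    inner ℂ (createParticle p q f.toH G) (createParticle p q h.toH E) =
      ∫ y, ((∫ s, (f.fn s * h.fn s * coupling p q s y ^ 2 : ℝ) ∂halfLine : ℝ) : ℂ) *
        inner ℂ (G y) (E y) ∂orthant n := by
  set φ : ℝ × (Fin n → ℝ) → ℂ := fun z =>
    ((f.fn z.1 * h.fn z.1 * coupling p q z.1 z.2 ^ 2 : ℝ) : ℂ) * inner ℂ (G z.2) (E z.2) with hφ
  have hae : (fun x => inner ℂ (createParticle p q f.toH G x) (createParticle p q h.toH E x))
      =ᵐ[orthant (n + 1)] fun x => φ (x 0, Fin.tail x) := by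
    filter_upwards [createParticle_coeFn p q f.toH G, createParticle_coeFn p q h.toH E,
      ae_head f.toH_coeFn, ae_head h.toH_coeFn] with x h1 h2 h3 h4
    rw [h1, h2, createFun, createFun, h3, h4, hφ]
    simp only [RCLike.inner_apply, map_mul, Complex.conj_ofReal, Complex.ofReal_mul,
      Complex.ofReal_pow]
    ring
  have hmp := measurePreserving_split n
  have hemb : MeasurableEmbedding (fun x : Fin (n + 1) → ℝ => (x 0, Fin.tail x)) :=
    (MeasurableEquiv.piFinSuccAbove (fun _ : Fin (n + 1) => ℝ) 0).measurableEmbedding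
  have hint : Integrable φ (halfLine.prod (orthant n)) := by
    rw [← hmp.integrable_comp_emb hemb]
    exact (L2.integrable_inner (𝕜 := ℂ) _ _).congr hae
  rw [L2.inner_def, integral_congr_ae hae, hmp.integral_comp hemb φ, integral_prod_symm φ hint]
  refine integral_congr_ae (Filter.Eventually.of_forall fun y => ?_)
  simp only [hφ]
  rw [integral_mul_const, integral_complex_ofReal]

theorem integral_profile_mul_coupling_zero (p q : ℝ) (f h : Profile) (y : Fin 0 → ℝ) :
    ∫ s, (f.fn s * h.fn s * coupling p q s y ^ 2 : ℝ) ∂halfLine = f.overlap h := by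
  have hf := f.measurable
  have hh := h.measurable
  rw [integral_eq_lintegral_of_nonneg_ae (Filter.Eventually.of_forall fun s => by positivity)]
  · rw [Profile.overlap, ENNReal.coe_toNNReal_eq_toReal]
    congr 1
    refine lintegral_congr fun s => ?_
    simp [coupling, ENNReal.ofReal_mul]
  · simp only [coupling]
    fun_prop

theorem integral_profile_mul_coupling_succ {p q : ℝ} (hp : 0 ≤ p) (hq : 0 ≤ q) (f h : Profile)
    {n : ℕ} (y : Fin (n + 1) → ℝ) :
    ∫ s, (f.fn s * h.fn s * coupling p q s y ^ 2 : ℝ) ∂halfLine = Profile.kernel p q f h (y 0) := by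
  have hf := f.measurable
  have hh := h.measurable
  have hw := measurable_weight p q
  simp only [coupling, Real.sq_sqrt (weight_nonneg hp hq _ _)]
  rw [integral_eq_lintegral_of_nonneg_ae (Filter.Eventually.of_forall fun s => ?_)]
  · rw [Profile.kernel, ENNReal.coe_toNNReal_eq_toReal]
    congr 1
    refine lintegral_congr fun s => ?_
    rw [ENNReal.ofReal_mul (by positivity), ENNReal.ofReal_mul (by positivity)]
    simp
  · have : Measurable fun s => weight p q s (y 0) :=
      hw.comp (measurable_id.prodMk measurable_const)
    fun_prop
  · have := weight_nonneg hp hq s (y 0)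
    positivity

theorem inner_createParticle_zero (p q : ℝ) (f h : Profile) (G E : Particle 0) :
    inner ℂ (createParticle p q f.toH G) (createParticle p q h.toH E) =
      ((f.overlap h : ℝ) : ℂ) * inner ℂ G E := by
  rw [inner_createParticle, L2.inner_def]
  simp only [integral_profile_mul_coupling_zero]
  rw [integral_const_mul]

theorem inner_createParticle_succ {p q : ℝ} (hp : 0 ≤ p) (hq : 0 ≤ q) (f h g : Profile) {n : ℕ}
    (G : Particle (n + 1)) (F : Particle n) :
    inner ℂ (createParticle p q f.toH G)
        (createParticle p q h.toH (createParticle p q g.toH F)) =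
      inner ℂ G (createParticle p q (Profile.contract p q hp hq f h g).toH F) := by
  rw [inner_createParticle, L2.inner_def]
  refine integral_congr_ae ?_
  filter_upwards [createParticle_coeFn p q g.toH F,
    createParticle_coeFn p q (Profile.contract p q hp hq f h g).toH F, ae_head g.toH_coeFn,
    ae_head (Profile.contract p q hp hq f h g).toH_coeFn] with y h1 h2 h3 h4
  rw [integral_profile_mul_coupling_succ hp hq, h1, h2, createFun, createFun, h3, h4]
  simp only [RCLike.inner_apply, Profile.contract, NNReal.coe_mul, Complex.ofReal_mul]
  ring

theorem inner_eq_tsum_succ (u v : Fock) (h : inner ℂ (u 0) (v 0) = 0) :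
    inner ℂ u v = ∑' n, inner ℂ (u (n + 1)) (v (n + 1)) := by
  have hs : Summable fun n => inner ℂ (u n) (v n) := lp.summable_inner u v
  rw [lp.inner_eq_tsum, hs.tsum_eq_zero_add, h, zero_add]

theorem inner_creation (p q : ℝ) (f : H) (u v : Fock) :
    inner ℂ (creation p q f u) v = ∑' n, inner ℂ (createParticle p q f (u n)) (v (n + 1)) :=
  inner_eq_tsum_succ _ _ (by rw [creation_apply_zero, inner_zero_left])

theorem inner_creation_right (p q : ℝ) (f : H) (u v : Fock) :
    inner ℂ u (creation p q f v) = ∑' n, inner ℂ (u (n + 1)) (createParticle p q f (v n)) :=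
  inner_eq_tsum_succ _ _ (by rw [creation_apply_zero, inner_zero_right])

theorem vacuum_apply_succ (n : ℕ) : vacuum (n + 1) = 0 :=
  lp.single_apply_ne 2 0 _ n.succ_ne_zero

theorem inner_vacuum_vacuum : inner ℂ vacuum vacuum = 1 := by
  rw [vacuum, lp.inner_single_left, lp.single_apply_self, L2.inner_def]
  have : (fun a => inner ℂ ((memLp_one_zero.toLp _ : Particle 0) a)
      ((memLp_one_zero.toLp _ : Particle 0) a)) =ᵐ[orthant 0] fun _ => (1 : ℂ) := by
    filter_upwards [memLp_one_zero.coeFn_toLp] with x hx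
    rw [hx]; simp
  rw [integral_congr_ae this]
  unfold orthant
  rw [Measure.pi_of_empty (fun _ : Fin 0 => halfLine)]
  simp

theorem inner_creation_vacuum (p q : ℝ) (f : H) (u : Fock) :
    inner ℂ (creation p q f u) vacuum = 0 := by
  rw [inner_creation]
  simp [vacuum_apply_succ]

theorem annihilation_vacuum (p q : ℝ) (f : H) : annihilation p q f vacuum = 0 := by
  refine ext_inner_left ℂ fun u => ?_
  rw [annihilation, ContinuousLinearMap.adjoint_inner_right, inner_creation_vacuum,
    inner_zero_right]

theorem createParticle_zero (p q : ℝ) (f : H) (n : ℕ) :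
    createParticle p q f (0 : Particle n) = 0 := by
  have := createParticle_smul p q f 0 (0 : Particle n)
  rwa [zero_smul, zero_smul] at this

theorem annihilation_creation_vacuum (p q : ℝ) (f h : Profile) :
    annihilation p q f.toH (creation p q h.toH vacuum) = ((f.overlap h : ℝ) : ℂ) • vacuum := by
  refine ext_inner_left ℂ fun u => ?_
  rw [annihilation, ContinuousLinearMap.adjoint_inner_right, inner_creation, inner_smul_right,
    lp.inner_eq_tsum, tsum_eq_single 0, tsum_eq_single 0, creation_apply_succ,
    inner_createParticle_zero]
  · intro n hn
    obtain ⟨n, rfl⟩ := Nat.exists_eq_succ_of_ne_zero hn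
    rw [Nat.succ_eq_add_one, vacuum_apply_succ, inner_zero_right]
  · intro n hn
    obtain ⟨n, rfl⟩ := Nat.exists_eq_succ_of_ne_zero hn
    rw [Nat.succ_eq_add_one, creation_apply_succ, vacuum_apply_succ, createParticle_zero,
      inner_zero_right]

/-- Annihilation acts on a product of at least two factors by replacing the two leading factors
`h`, `g` by the single factor `g · ∫ f(t) h(t) w(t, ·) dt`: the square roots in the creation
operators recombine to the full weight. -/
theorem annihilation_creation_creation {p q : ℝ} (hp : 0 ≤ p) (hq : 0 ≤ q) (f h g : Profile)
    (v : Fock) :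
    annihilation p q f.toH (creation p q h.toH (creation p q g.toH v)) =
      creation p q (Profile.contract p q hp hq f h g).toH v := by
  refine ext_inner_left ℂ fun u => ?_
  have hs : Summable fun n => inner ℂ (creation p q f.toH u n)
      (creation p q h.toH (creation p q g.toH v) n) := lp.summable_inner _ _
  have hs' : Summable fun n => inner ℂ (createParticle p q f.toH (u n))
      (createParticle p q h.toH (creation p q g.toH v n)) := (summable_nat_add_iff 1).2 hs
  rw [annihilation, ContinuousLinearMap.adjoint_inner_right, inner_creation, inner_creation_right]
  simp only [creation_apply_succ]
  -- The component of degree one of `h ⊛ (g ⊛ v)` vanishes, so the right-hand sum is a shift.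
  rw [hs'.tsum_eq_zero_add, creation_apply_zero, createParticle_zero, inner_zero_right, zero_add]
  refine tsum_congr fun n => ?_
  rw [creation_apply_succ, inner_createParticle_succ hp hq]

theorem inner_gaussian (p q : ℝ) (f : H) (u v : Fock) :
    inner ℂ u (gaussian p q f v) = inner ℂ (gaussian p q f u) v := by
  simp only [gaussian, annihilation, add_apply, inner_add_left,
    inner_add_right, ContinuousLinearMap.adjoint_inner_left,
    ContinuousLinearMap.adjoint_inner_right]
  ring

/-- The product vector `h₁ ⊛ ⋯ ⊛ hₘ = a(h₁) ⋯ a(hₘ) Ω`. -/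
def productVector (p q : ℝ) : List Profile → Fock
  | [] => vacuum
  | h :: hs => creation p q h.toH (productVector p q hs)

/-- The pairing `⟨h₁ ⊛ ⋯ ⊛ hₘ, ω(f₁) ⋯ ω(fₙ) Ω⟩`, computed by reading the word `f₁, …, fₙ` from
the left: each letter is either pushed onto the stack `h₁, …, hₘ` (creation) or contracted with
its top element (annihilation). -/
def pairing (p q : ℝ) (hp : 0 ≤ p) (hq : 0 ≤ q) : List Profile → List Profile → ℝ≥0
  | [], [] => 1
  | [], _ :: _ => 0
  | f :: w, [] => pairing p q hp hq w [f]
  | f :: w, [h] => pairing p q hp hq w [f, h] + f.overlap h * pairing p q hp hq w []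
  | f :: w, h :: g :: hs => pairing p q hp hq w (f :: h :: g :: hs) +
      pairing p q hp hq w (Profile.contract p q hp hq f h g :: hs)

/-- Since `ω(f)` is self-adjoint, the letters can be moved one by one to the left argument, where
they act on product vectors. -/
theorem inner_productVector {p q : ℝ} (hp : 0 ≤ p) (hq : 0 ≤ q) (w hs : List Profile) :
    inner ℂ (productVector p q hs) ((w.map fun f => gaussian p q f.toH).prod vacuum) =
      ((pairing p q hp hq w hs : ℝ) : ℂ) := by
  induction w generalizing hs with
  | nil =>
    rw [List.map_nil, List.prod_nil, one_apply_eq_self]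
    cases hs with
    | nil => rw [productVector, inner_vacuum_vacuum]; simp [pairing]
    | cons h hs => simp [productVector, pairing, inner_creation_vacuum]
  | cons f w ih =>
    rw [List.map_cons, List.prod_cons, mul_apply_eq_comp, inner_gaussian, gaussian,
      add_apply, inner_add_left]
    have hpush : creation p q f.toH (productVector p q hs) = productVector p q (f :: hs) := rfl
    rw [hpush, ih]
    match hs with
    | [] => simp [productVector, pairing, annihilation_vacuum]
    | [h] =>
      have h1 : annihilation p q f.toH (productVector p q [h]) =
        ((f.overlap h : ℝ) : ℂ) • productVector p q [] := annihilation_creation_vacuum p q f h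
      rw [h1, inner_smul_left, ih]
      simp [pairing]
    | h :: g :: hs =>
      have h1 : annihilation p q f.toH (productVector p q (h :: g :: hs)) =
          productVector p q (Profile.contract p q hp hq f h g :: hs) :=
        annihilation_creation_creation hp hq f h g _
      rw [h1, ih]
      simp [pairing]

/-- The pairing vanishes unless the word is long enough to empty the stack and has the right
parity. -/
theorem pairing_eq_zero {p q : ℝ} (hp : 0 ≤ p) (hq : 0 ≤ q) (w hs : List Profile)
    (h : w.length < hs.length ∨ (w.length + hs.length) % 2 = 1) :
    pairing p q hp hq w hs = 0 := by
  induction w generalizing hs with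
  | nil =>
    cases hs with
    | nil => simp at h
    | cons => rfl
  | cons f w ih =>
    match hs with
    | [] =>
      rw [pairing, ih]
      simp only [List.length_cons, List.length_nil] at *; omega
    | [h] =>
      rw [pairing, ih, ih]
      · simp
      all_goals simp only [List.length_cons, List.length_nil] at *; omega
    | h :: g :: hs =>
      rw [pairing, ih, ih, add_zero]
      all_goals simp only [List.length_cons] at *; omega

/-! ### Integration over labelled configurations -/

section Labelled

variable {k : ℕ}

/-- The weight `w(t_l, t_m)` paid for closing the block `l` at the top of a stack of open blocks,
where `m` is the next open block; there is no such factor if `l` was the only one. -/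
def closeWeight (p q : ℝ) (t : Fin k → ℝ) (l : Fin k) : List (Fin k) → ℝ
  | [] => 1
  | m :: _ => weight p q (t l) (t m)

/-- The total contribution of all ways to read the word with a stack `L` of labels of open blocks
and a set `U` of labels not used so far, at the point `t`: each letter either opens a block with a
label of `U` or closes the block at the top of the stack, and contributes its value at the
coordinate of that block. In the end all labels have to be used and all blocks closed. -/
def labelled (p q : ℝ) : List Profile → List (Fin k) → Finset (Fin k) → (Fin k → ℝ) → ℝ≥0∞
  | [], L, U, _ => if L = [] ∧ U = ∅ then 1 else 0
  | f :: w, [], U, t => ∑ l ∈ U, f.fn (t l) * labelled p q w [l] (U.erase l) t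
  | f :: w, l :: L, U, t => ∑ m ∈ U, f.fn (t m) * labelled p q w (m :: l :: L) (U.erase m) t +
      f.fn (t l) * ENNReal.ofReal (closeWeight p q t l L) * labelled p q w L U t

theorem measurable_closeWeight (p q : ℝ) (l : Fin k) (L : List (Fin k)) :
    Measurable fun t => closeWeight p q t l L := by
  cases L with
  | nil => exact measurable_const
  | cons m L =>
    have h : Measurable fun t : Fin k → ℝ => (t l, t m) := by fun_prop
    exact (measurable_weight p q).comp h

theorem measurable_labelled (p q : ℝ) (w : List Profile) (L : List (Fin k)) (U : Finset (Fin k)) :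
    Measurable (labelled p q w L U) := by
  induction w generalizing L U with
  | nil => exact measurable_const
  | cons f w ih =>
    have hf := f.measurable
    cases L with
    | nil =>
      refine Finset.measurable_fun_sum U (f := fun l t =>
        (f.fn (t l) : ℝ≥0∞) * labelled p q w [l] (U.erase l) t) fun l _ => ?_
      have := ih [l] (U.erase l)
      fun_prop
    | cons l L =>
      refine (Finset.measurable_fun_sum U (f := fun m t =>
        (f.fn (t m) : ℝ≥0∞) * labelled p q w (m :: l :: L) (U.erase m) t) fun m _ => ?_).add
          (g := fun t => (f.fn (t l) : ℝ≥0∞) * ENNReal.ofReal (closeWeight p q t l L) *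
            labelled p q w L U t) ?_
      · have := ih (m :: l :: L) (U.erase m)
        fun_prop
      · have := ih L U
        have := measurable_closeWeight p q l L
        fun_prop

/-- Only the coordinates of the open blocks and of the unused labels matter. -/
theorem labelled_congr (p q : ℝ) (w : List Profile) (L : List (Fin k)) (U : Finset (Fin k))
    {t t' : Fin k → ℝ} (hL : ∀ l ∈ L, t l = t' l) (hU : ∀ l ∈ U, t l = t' l) :
    labelled p q w L U t = labelled p q w L U t' := by
  induction w generalizing L U with
  | nil => rfl
  | cons f w ih =>
    have hsum (L : List (Fin k)) (hL : ∀ l ∈ L, t l = t' l) :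
        ∑ m ∈ U, f.fn (t m) * labelled p q w (m :: L) (U.erase m) t =
        ∑ m ∈ U, f.fn (t' m) * labelled p q w (m :: L) (U.erase m) t' := by
      refine Finset.sum_congr rfl fun m hm => ?_
      rw [hU m hm, ih (m :: L) (U.erase m)]
      · simpa [hU m hm] using hL
      · exact fun l hl => hU l (Finset.mem_of_mem_erase hl)
    cases L with
    | nil => exact hsum [] hL
    | cons l L =>
      rw [List.forall_mem_cons] at hL
      simp only [labelled]
      rw [hsum (l :: L) (List.forall_mem_cons.2 hL), ih L U hL.2 hU, hL.1]
      congr 3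
      cases L with
      | nil => rfl
      | cons m L => simp only [closeWeight, hL.1, hL.2 m List.mem_cons_self]

/-- The product of the stack profiles at the coordinates given by the stack labels. -/
def stackProd (hs : List Profile) (L : List (Fin k)) (t : Fin k → ℝ) : ℝ≥0∞ :=
  (List.zipWith (fun h l => (h.fn (t l) : ℝ≥0∞)) hs L).prod

theorem stackProd_cons (h : Profile) (hs : List Profile) (l : Fin k) (L : List (Fin k))
    (t : Fin k → ℝ) : stackProd (h :: hs) (l :: L) t = h.fn (t l) * stackProd hs L t := by
  simp [stackProd]

theorem measurable_stackProd (hs : List Profile) (L : List (Fin k)) :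
    Measurable (stackProd hs L) := by
  induction hs generalizing L with
  | nil => exact measurable_const
  | cons h hs ih =>
    cases L with
    | nil => exact measurable_const
    | cons l L =>
      have := ih L
      have := h.measurable
      simp only [funext (stackProd_cons h hs l L)]
      fun_prop

theorem stackProd_congr (hs : List Profile) (L : List (Fin k)) {t t' : Fin k → ℝ}
    (hL : ∀ l ∈ L, t l = t' l) : stackProd hs L t = stackProd hs L t' := by
  induction hs generalizing L with
  | nil => rfl
  | cons h hs ih =>
    cases L with
    | nil => rfl
    | cons l L =>
      rw [List.forall_mem_cons] at hL
      rw [stackProd_cons, stackProd_cons, hL.1, ih L hL.2]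

theorem lmarginal_add {δ : Type*} [DecidableEq δ] {X : δ → Type*} [∀ i, MeasurableSpace (X i)]
    (μ : ∀ i, Measure (X i)) (s : Finset δ) {f g : (∀ i, X i) → ℝ≥0∞} (hf : Measurable f)
    (x : ∀ i, X i) :
    (∫⋯∫⁻_s, (fun t => f t + g t) ∂μ) x = (∫⋯∫⁻_s, f ∂μ) x + (∫⋯∫⁻_s, g ∂μ) x :=
  lintegral_add_left (hf.comp measurable_updateFinset) _

theorem lmarginal_sum {δ ι : Type*} [DecidableEq δ] {X : δ → Type*} [∀ i, MeasurableSpace (X i)]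
    (μ : ∀ i, Measure (X i)) (s : Finset δ) (I : Finset ι) {f : ι → (∀ i, X i) → ℝ≥0∞}
    (hf : ∀ i, Measurable (f i)) (x : ∀ i, X i) :
    (∫⋯∫⁻_s, (fun t => ∑ i ∈ I, f i t) ∂μ) x = ∑ i ∈ I, (∫⋯∫⁻_s, f i ∂μ) x :=
  lintegral_finsetSum _ fun i _ => (hf i).comp measurable_updateFinset

theorem lmarginal_const_mul {δ : Type*} [DecidableEq δ] {X : δ → Type*}
    [∀ i, MeasurableSpace (X i)] (μ : ∀ i, Measure (X i)) (s : Finset δ)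
    {f : (∀ i, X i) → ℝ≥0∞} (hf : Measurable f) (c : ℝ≥0∞) (x : ∀ i, X i) :
    (∫⋯∫⁻_s, (fun t => c * f t) ∂μ) x = c * (∫⋯∫⁻_s, f ∂μ) x :=
  lintegral_const_mul c (hf.comp measurable_updateFinset)

/-- The opening part of the recursion: the sum over the label of the new block contributes the
factor `|U|`. -/
theorem lmarginal_open {p q : ℝ} (hp : 0 ≤ p) (hq : 0 ≤ q) (f : Profile) (w hs : List Profile)
    (L : List (Fin k)) (U : Finset (Fin k)) (x : Fin k → ℝ)
    (hlen : L.length = hs.length) (hw : 2 * U.card + L.length = w.length + 1)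
    (ih : ∀ l ∈ U, ((U.erase l).card.factorial * pairing p q hp hq w (f :: hs) : ℝ≥0∞) =
      (∫⋯∫⁻_((l :: L).toFinset ∪ U.erase l),
        (fun t => stackProd (f :: hs) (l :: L) t * labelled p q w (l :: L) (U.erase l) t)
        ∂fun _ => halfLine) x) :
    (U.card.factorial * pairing p q hp hq w (f :: hs) : ℝ≥0∞) =
      (∫⋯∫⁻_(L.toFinset ∪ U), (fun t => stackProd hs L t *
        ∑ l ∈ U, f.fn (t l) * labelled p q w (l :: L) (U.erase l) t) ∂fun _ => halfLine) x := by
  have hf := f.measurable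
  simp only [Finset.mul_sum]
  rw [lmarginal_sum]
  · have h1 : ∀ l ∈ U, (∫⋯∫⁻_(L.toFinset ∪ U), (fun t => stackProd hs L t *
        (f.fn (t l) * labelled p q w (l :: L) (U.erase l) t)) ∂fun _ => halfLine) x =
        (((U.card - 1).factorial * pairing p q hp hq w (f :: hs) : ℝ≥0∞)) := by
      intro l hl
      rw [← Finset.card_erase_of_mem hl, ih l hl]
      have h2 : (l :: L).toFinset ∪ U.erase l = L.toFinset ∪ U := by
        ext m
        by_cases hm : m = l
        · simp [hm, hl]
        · simp [hm]
      rw [h2]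
      refine congrFun (congrArg _ (funext fun t => ?_)) x
      rw [stackProd_cons]
      ring
    rw [Finset.sum_congr rfl h1, Finset.sum_const, nsmul_eq_mul, ← mul_assoc, ← Nat.cast_mul]
    rcases Nat.eq_zero_or_pos U.card with h0 | h0
    · -- Without unused labels the word is too short to close one more block.
      rw [pairing_eq_zero]
      · simp
      · left
        simp only [List.length_cons]
        omega
    · rw [Nat.mul_factorial_pred h0.ne']
  · intro l
    have := measurable_stackProd hs L
    have := measurable_labelled p q w (l :: L) (U.erase l)
    fun_prop

/-- The stack recursion as an integral. The labels of the stack and the unused labels are the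
variables of integration; closing a block integrates out its variable, which no later factor
involves, and turns the profile below it into its contraction. The count `2 |U| + |L| = |w|` says
that the word has just the right length to use all labels and to close all blocks. -/
theorem factorial_mul_pairing {p q : ℝ} (hp : 0 ≤ p) (hq : 0 ≤ q) (w hs : List Profile)
    (L : List (Fin k)) (U : Finset (Fin k)) (x : Fin k → ℝ) (hL : L.Nodup)
    (hd : Disjoint L.toFinset U) (hlen : L.length = hs.length)
    (hw : 2 * U.card + L.length = w.length) :
    (U.card.factorial * pairing p q hp hq w hs : ℝ≥0∞) =
      (∫⋯∫⁻_(L.toFinset ∪ U), (fun t => stackProd hs L t * labelled p q w L U t)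
        ∂fun _ => halfLine) x := by
  induction w generalizing hs L U x with
  | nil =>
    rw [List.length_nil] at hw
    obtain rfl : U = ∅ := Finset.card_eq_zero.1 (by omega)
    obtain rfl : L = [] := List.length_eq_zero_iff.1 (by omega)
    obtain rfl : hs = [] := List.length_eq_zero_iff.1 hlen.symm
    simp [pairing, labelled, stackProd]
  | cons f w ih =>
    have hf := f.measurable
    have hopen := lmarginal_open hp hq f w hs L U x hlen hw (fun l hl => by
      have hl' : l ∉ L := fun h => Finset.disjoint_left.1 hd (List.mem_toFinset.2 h) hl
      refine ih (f :: hs) (l :: L) (U.erase l) x (List.nodup_cons.2 ⟨hl', hL⟩) ?_ (by simp [hlen])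
        ?_
      · rw [List.toFinset_cons, Finset.disjoint_insert_left]
        exact ⟨Finset.notMem_erase _ _, hd.mono_right (Finset.erase_subset _ _)⟩
      · have := Finset.card_pos.2 ⟨l, hl⟩
        rw [Finset.card_erase_of_mem hl]
        simp only [List.length_cons] at hw ⊢
        omega)
    match L, hs with
    | [], [] => exact hopen
    | l :: L, h :: hs =>
      have hh := h.measurable
      obtain ⟨hl, hL'⟩ := List.nodup_cons.1 hL
      rw [List.toFinset_cons, Finset.disjoint_insert_left] at hd
      have hlS : l ∉ L.toFinset ∪ U := by
        rw [Finset.mem_union, List.mem_toFinset]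
        exact fun h => h.elim hl hd.1
      have hne {m : Fin k} (hm : m ∈ L.toFinset ∪ U) : m ≠ l := fun h => hlS (h ▸ hm)
      have hml := measurable_labelled p q w L U
      have hms := measurable_stackProd hs L
      have hmw := measurable_closeWeight p q l L
      have hclose : (∫⋯∫⁻_((l :: L).toFinset ∪ U), (fun t => stackProd (h :: hs) (l :: L) t *
          (f.fn (t l) * ENNReal.ofReal (closeWeight p q t l L) * labelled p q w L U t))
          ∂fun _ => halfLine) x =
          (∫⋯∫⁻_(L.toFinset ∪ U), (fun t => (∫⁻ s, f.fn s * h.fn s *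
            ENNReal.ofReal (closeWeight p q (Function.update t l s) l L) ∂halfLine) *
              (stackProd hs L t * labelled p q w L U t)) ∂fun _ => halfLine) x := by
        simp only [stackProd_cons]
        rw [List.toFinset_cons, Finset.insert_union, lmarginal_insert' _ (by fun_prop) hlS]
        refine congrFun (congrArg _ (funext fun t => ?_)) x
        rw [← lintegral_mul_const]
        · refine lintegral_congr fun s => ?_
          rw [Function.update_self, stackProd_congr hs L (t' := t),
            labelled_congr p q w L U (t' := t)]
          · ring
          · exact fun m hm => Function.update_of_ne (hne (by simp [hm])) _ _
          · exact fun m hm => Function.update_of_ne (hne (by simp [hm])) _ _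
          · exact fun m hm => Function.update_of_ne (hne (by simp [hm])) _ _
        · have : Measurable fun s => closeWeight p q (Function.update t l s) l L :=
            hmw.comp (measurable_update t)
          fun_prop
      simp only [labelled, mul_add]
      rw [lmarginal_add, ← hopen, hclose]
      · match L, hs with
        | [], [] =>
          have h1 := ih [] [] U x List.nodup_nil (by simp) rfl
            (by simp only [List.length_cons, List.length_nil] at hw ⊢; omega)
          simp only [closeWeight, ENNReal.ofReal_one, mul_one]
          rw [lmarginal_const_mul _ _ (by fun_prop), ← h1, ← Profile.coe_overlap, pairing]
          push_cast
          ring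
        | m :: L, g :: hs =>
          have h1 := ih (Profile.contract p q hp hq f h g :: hs) (m :: L) U x hL' hd.2
            (by simpa using hlen)
            (by simp only [List.length_cons] at hw ⊢; omega)
          rw [pairing, ENNReal.coe_add, mul_add, h1]
          congr 1
          refine congrFun (congrArg _ (funext fun t => ?_)) x
          have hml : m ≠ l := hne (by simp)
          simp only [closeWeight, Function.update_self, Function.update_of_ne hml]
          rw [← Profile.coe_kernel hp hq, stackProd_cons, stackProd_cons, Profile.contract]
          push_cast
          ring
      · have (m : Fin k) := measurable_labelled p q w (m :: l :: L) (U.erase m)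
        have := measurable_stackProd (h :: hs) (l :: L)
        fun_prop
end Labelled

/-! ### Non-crossing words and the stack recursion -/

section Words

variable {α : Type*}

/-- A word is crossing-free if it has no subword `a b a b` with `a ≠ b`. -/
def CrossingFree (W : List α) : Prop := ∀ a b, a ≠ b → ¬ [a, b, a, b].Sublist W

/-- The letter `b` encloses the letter `l`: there is a subword `b l l b`. In a word in which each
letter occurs twice this excludes `b = l`. -/
def Encloses (W : List α) (b l : α) : Prop := [b, l, l, b].Sublist W

/-- The letter `b` encloses `l`, and there is no letter in between. -/
def EnclosesNext (W : List α) (b l : α) : Prop :=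
  Encloses W b l ∧ ∀ m, ¬ (Encloses W b m ∧ Encloses W m l)

theorem pair_sublist_of_mem {l : List α} {a b : α} (h : a ≠ b) (ha : a ∈ l) (hb : b ∈ l) :
    [a, b].Sublist l ∨ [b, a].Sublist l := by
  induction l with
  | nil => simp at ha
  | cons c l ih =>
    rcases List.mem_cons.1 ha with rfl | ha
    · left
      simpa [h.symm] using hb
    · rcases List.mem_cons.1 hb with rfl | hb
      · right
        simpa [h] using ha
      · exact (ih ha hb).imp (fun h => h.cons c) (fun h => h.cons c)

section Adjacent

variable {X Y : List α} {c : α}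

theorem sublist_append_cons_cons (hX : c ∉ X) (hY : c ∉ Y) {s : List α} (hs : c ∉ s) :
    s.Sublist (X ++ c :: c :: Y) ↔ s.Sublist (X ++ Y) := by
  classical
  constructor
  · intro h
    have hf {Z : List α} (hZ : c ∉ Z) : Z.filter (fun x => decide (x ≠ c)) = Z :=
      List.filter_eq_self.2 fun x hx => by
        simp only [ne_eq, decide_eq_true_eq]
        rintro rfl
        exact hZ hx
    have := h.filter fun x => decide (x ≠ c)
    rw [hf hs, List.filter_append, hf hX, List.filter_cons_of_neg (by simp),
      List.filter_cons_of_neg (by simp), hf hY] at this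
    exact this
  · intro h
    exact h.trans ((List.Sublist.refl X).append ((List.sublist_cons_self c _).trans
      (List.sublist_cons_self c _)))

theorem not_sublist_adjacent (hX : c ∉ X) (hY : c ∉ Y) (x : α) :
    ¬ [c, x, c].Sublist (X ++ c :: c :: Y) := by
  intro h
  obtain ⟨l₁, l₂, h12, h1, h2⟩ := List.sublist_append_iff.1 h
  cases l₁ with
  | cons a l₁ =>
    obtain rfl : c = a := by simpa using congrArg List.head? h12
    exact hX (h1.subset List.mem_cons_self)
  | nil =>
    rw [List.nil_append] at h12
    rw [← h12, List.cons_sublist_cons] at h2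
    rcases eq_or_ne x c with rfl | hx
    · rw [List.cons_sublist_cons] at h2
      exact hY (h2.subset (by simp))
    · have : [x, c].Sublist Y := by
        cases h2 with
        | cons _ h => exact h
        | cons_cons _ h => exact absurd rfl hx
      exact hY (this.subset (by simp))

/-- Removing two adjacent occurrences of a letter does not affect crossings. -/
theorem crossingFree_adjacent (hX : c ∉ X) (hY : c ∉ Y) :
    CrossingFree (X ++ c :: c :: Y) ↔ CrossingFree (X ++ Y) := by
  refine forall₂_congr fun a b => forall_congr' fun hab => ?_
  by_cases ha : a = c
  · subst ha
    refine iff_of_true (fun h => not_sublist_adjacent hX hY b ?_) (fun h => ?_)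
    · exact (List.Sublist.trans (by simp) h)
    · have := h.subset (a := a) (by simp)
      simp [hX, hY] at this
  · by_cases hb : b = c
    · subst hb
      refine iff_of_true (fun h => not_sublist_adjacent hX hY a ?_) (fun h => ?_)
      · exact ((List.sublist_cons_self a _).trans h)
      · have := h.subset (a := b) (by simp)
        simp [hX, hY] at this
    · rw [sublist_append_cons_cons hX hY (by simp [Ne.symm ha, Ne.symm hb])]

theorem not_encloses_of_adjacent (hX : c ∉ X) (hY : c ∉ Y) (l : α) :
    ¬ Encloses (X ++ c :: c :: Y) c l := fun h =>
  not_sublist_adjacent hX hY l (List.Sublist.trans (by simp) h)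

theorem encloses_adjacent (hX : c ∉ X) (hY : c ∉ Y) {b l : α} (hb : b ≠ c) (hl : l ≠ c) :
    Encloses (X ++ c :: c :: Y) b l ↔ Encloses (X ++ Y) b l :=
  sublist_append_cons_cons hX hY (by simp [hb.symm, hl.symm])

theorem not_encloses_of_notMem {W : List α} (hW : c ∉ W) (b : α) : ¬ Encloses W b c := fun h =>
  hW (h.subset (by simp))

theorem not_encloses_of_notMem' {W : List α} (hW : c ∉ W) (l : α) : ¬ Encloses W c l := fun h =>
  hW (h.subset (by simp))

theorem mem_of_encloses_adjacent (hY : c ∉ Y) {b : α} (hb : b ≠ c)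
    (h : Encloses (X ++ c :: c :: Y) b c) : b ∈ X := by
  obtain ⟨l₁, l₂, h12, h1, h2⟩ := List.sublist_append_iff.1 h
  cases l₁ with
  | cons a l₁ =>
    obtain rfl : b = a := by simpa using congrArg List.head? h12
    exact h1.subset List.mem_cons_self
  | nil =>
    rw [List.nil_append] at h12
    subst h12
    have h3 : [b, c, c, b].Sublist Y := by
      cases h2 with
      | cons _ h =>
        cases h with
        | cons _ h => exact h
        | cons_cons _ h => exact absurd rfl hb
      | cons_cons _ h => exact absurd rfl hb
    exact absurd (h3.subset (by simp)) hY

theorem encloses_adjacent_of_mem {b : α} (hX : b ∈ X) (hY : b ∈ Y) :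
    Encloses (X ++ c :: c :: Y) b c := by
  have h1 : [b].Sublist X := List.singleton_sublist.2 hX
  have h2 : [b].Sublist Y := List.singleton_sublist.2 hY
  exact h1.append ((h2.cons_cons c).cons_cons c)

theorem enclosesNext_adjacent (hX : c ∉ X) (hY : c ∉ Y) {b l : α} (hl : l ≠ c) :
    EnclosesNext (X ++ c :: c :: Y) b l ↔ EnclosesNext (X ++ Y) b l := by
  have hXY : c ∉ X ++ Y := by simp [hX, hY]
  by_cases hb : b = c
  · subst hb
    exact iff_of_false (fun h => not_encloses_of_adjacent hX hY l h.1)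
      (fun h => not_encloses_of_notMem' hXY l h.1)
  · rw [EnclosesNext, EnclosesNext, encloses_adjacent hX hY hb hl]
    refine and_congr_right fun _ => forall_congr' fun m => ?_
    by_cases hm : m = c
    · subst hm
      exact iff_of_true (fun h => not_encloses_of_adjacent hX hY l h.2)
        (fun h => not_encloses_of_notMem' hXY l h.2)
    · rw [encloses_adjacent hX hY hb hm, encloses_adjacent hX hY hm hl]

end Adjacent

open Classical in
/-- The product of the weights over all pairs of a block and its neighboring outer block. -/
def nestingWeight [Fintype α] (wt : α → α → ℝ≥0∞) (W : List α) : ℝ≥0∞ :=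
  ∏ x : α × α with EnclosesNext W x.2 x.1, wt x.1 x.2

theorem nestingWeight_nil [Fintype α] (wt : α → α → ℝ≥0∞) : nestingWeight wt ([] : List α) = 1 := by
  classical
  rw [nestingWeight, Finset.filter_false_of_mem, Finset.prod_empty]
  intro x _ h
  have := h.1
  simp [Encloses] at this

variable [DecidableEq α]

/-- The innermost open block is the one that encloses a block which opens and closes next. -/
theorem enclosesNext_head {h c : α} {L Y : List α} (hL : (h :: L).Nodup) (hc : c ∉ h :: L)
    (hY : c ∉ Y) (hcount : ∀ m ∈ h :: L, Y.count m = 1)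
    (hcf : CrossingFree ((h :: L).reverse ++ c :: c :: Y)) (b : α) :
    EnclosesNext ((h :: L).reverse ++ c :: c :: Y) b c ↔ b = h := by
  have hX : c ∉ (h :: L).reverse := by rwa [List.mem_reverse]
  have hmemY {m : α} (hm : m ∈ h :: L) : m ∈ Y :=
    List.count_pos_iff.1 (by rw [hcount m hm]; exact one_pos)
  constructor
  · rintro ⟨h1, h2⟩
    by_contra hbh
    have hbc : b ≠ c := by
      rintro rfl
      exact not_encloses_of_adjacent hX hY b h1
    have hb : b ∈ h :: L := List.mem_reverse.1 (mem_of_encloses_adjacent hY hbc h1)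
    have hb' : b ∈ L := (List.mem_cons.1 hb).resolve_left hbh
    have hh : h ∈ h :: L := List.mem_cons_self
    refine h2 h ⟨?_, encloses_adjacent_of_mem (by simp) (hmemY hh)⟩
    have h3 : [b, h].Sublist (h :: L).reverse := by
      rw [List.reverse_cons]
      exact List.Sublist.append (List.singleton_sublist.2 (by simpa using hb'))
        (List.Sublist.refl [h])
    have h4 : Y.Sublist (c :: c :: Y) :=
      (List.sublist_cons_self c _).trans (List.sublist_cons_self c _)
    rcases pair_sublist_of_mem hbh (hmemY hb) (hmemY hh) with h5 | h5
    · exact absurd (h3.append (h5.trans h4)) (hcf b h hbh)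
    · exact h3.append (h5.trans h4)
  · rintro rfl
    have hb : b ∈ b :: L := List.mem_cons_self
    refine ⟨encloses_adjacent_of_mem (by simp) (hmemY hb), fun m hm => ?_⟩
    have hmc : m ≠ c := by
      rintro rfl
      exact not_encloses_of_adjacent hX hY m hm.2
    have hm' : m ∈ b :: L := List.mem_reverse.1 (mem_of_encloses_adjacent hY hmc hm.2)
    have h1 : [b, m, m].Sublist (L.reverse ++ b :: c :: c :: Y) := by
      have := hm.1
      rw [Encloses, List.reverse_cons, List.append_assoc] at this
      exact List.Sublist.trans (by simp) this
    obtain ⟨l₁, l₂, h12, h2, h3⟩ := List.sublist_append_iff.1 h1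
    cases l₁ with
    | cons a l₁ =>
      obtain rfl : b = a := by simpa using congrArg List.head? h12
      have := h2.subset List.mem_cons_self
      exact (List.nodup_cons.1 hL).1 (by simpa using this)
    | nil =>
      rw [List.nil_append] at h12
      subst h12
      rw [List.cons_sublist_cons] at h3
      have := h3.count_le m
      rw [List.count_cons_of_ne hmc.symm, List.count_cons_of_ne hmc.symm, hcount m hm'] at this
      simp at this

/-- The weight paid for closing the block `l` when `m` is the next open block on the stack. -/
def closeFactor (wt : α → α → ℝ≥0∞) (l : α) : List α → ℝ≥0∞
  | [] => 1
  | m :: _ => wt l m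

/-- The contribution of a single labelled word to the stack recursion, starting from a stack `L`
of open labels and a set `U` of unused labels. -/
def run (wt : α → α → ℝ≥0∞) : List α → List α → Finset α → ℝ≥0∞
  | [], L, U => if L = [] ∧ U = ∅ then 1 else 0
  | c :: cs, [], U => if c ∈ U then run wt cs [c] (U.erase c) else 0
  | c :: cs, l :: L, U => if c ∈ U then run wt cs (c :: l :: L) (U.erase c) else
      if c = l then closeFactor wt l L * run wt cs L U else 0

/-- The word `cs` completes the stack `L` and the unused labels `U` to a non-crossing pairing. The
open blocks are recorded by prefixing `cs` with the letters that opened them. -/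
def Completes (cs L : List α) (U : Finset α) : Prop :=
  (∀ l, cs.count l = if l ∈ L then 1 else if l ∈ U then 2 else 0) ∧
    CrossingFree (L.reverse ++ cs)

theorem completes_open {c : α} {cs L : List α} {U : Finset α} (hd : Disjoint L.toFinset U)
    (hc : c ∈ U) : Completes (c :: cs) L U ↔ Completes cs (c :: L) (U.erase c) := by
  have hcL : c ∉ L := fun h => Finset.disjoint_left.1 hd (List.mem_toFinset.2 h) hc
  refine and_congr (forall_congr' fun l => ?_) (by simp)
  by_cases hl : l = c
  · subst hl
    simp [hcL, hc]
  · simp [hl, List.count_cons_of_ne (Ne.symm hl)]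

theorem completes_close {c : α} {cs L : List α} {U : Finset α} (hcL : c ∉ L) (hcU : c ∉ U) :
    Completes (c :: cs) (c :: L) U ↔ Completes cs L U := by
  have h1 : (∀ l, (c :: cs).count l = if l ∈ c :: L then 1 else if l ∈ U then 2 else 0) ↔
      ∀ l, cs.count l = if l ∈ L then 1 else if l ∈ U then 2 else 0 := by
    refine forall_congr' fun l => ?_
    by_cases hl : l = c
    · subst hl
      simp [hcL, hcU]
    · simp [hl, List.count_cons_of_ne (Ne.symm hl)]
  rw [Completes, Completes, h1]
  refine and_congr_right fun h => ?_
  have hcs : c ∉ cs := by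
    have := h c
    rwa [if_neg hcL, if_neg hcU, List.count_eq_zero] at this
  rw [List.reverse_cons, List.append_assoc, List.singleton_append,
    crossingFree_adjacent (by simpa using hcL) hcs]

theorem nestingWeight_close [Fintype α] (wt : α → α → ℝ≥0∞) {c : α} {cs L : List α}
    {U : Finset α} (hL : (c :: L).Nodup) (hcU : c ∉ U) (h : Completes (c :: cs) (c :: L) U) :
    nestingWeight wt ((c :: L).reverse ++ c :: cs) =
      closeFactor wt c L * nestingWeight wt (L.reverse ++ cs) := by
  classical
  obtain ⟨hcL, hL'⟩ := List.nodup_cons.1 hL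
  have h' := (completes_close hcL hcU).1 h
  have hcs : c ∉ cs := by
    have := h'.1 c
    rwa [if_neg hcL, if_neg hcU, List.count_eq_zero] at this
  have hX : c ∉ L.reverse := by simpa using hcL
  have hW : (c :: L).reverse ++ c :: cs = L.reverse ++ c :: c :: cs := by simp
  have hnot (b : α) : ¬ EnclosesNext (L.reverse ++ cs) b c := fun hb =>
    not_encloses_of_notMem (by simp [hcL, hcs]) b hb.1
  rw [hW, nestingWeight, nestingWeight]
  cases L with
  | nil =>
    rw [closeFactor, one_mul]
    refine Finset.prod_congr (Finset.filter_congr fun x _ => ?_) fun _ _ => rfl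
    by_cases hx : x.1 = c
    · rw [hx]
      refine iff_of_false (fun hb => ?_) (hnot _)
      by_cases hbc : x.2 = c
      · exact not_encloses_of_adjacent hX hcs c (hbc ▸ hb.1)
      · simpa using mem_of_encloses_adjacent hcs hbc hb.1
    · exact enclosesNext_adjacent hX hcs hx
  | cons m L =>
    have hhead := enclosesNext_head hL' hcL hcs (fun l hl => by rw [h'.1 l, if_pos hl])
      (hW ▸ h.2)
    have hins : (Finset.univ.filter fun x : α × α =>
        EnclosesNext ((m :: L).reverse ++ c :: c :: cs) x.2 x.1) =
        insert (c, m) (Finset.univ.filter fun x : α × α =>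
          EnclosesNext ((m :: L).reverse ++ cs) x.2 x.1) := by
      ext ⟨l, b⟩
      simp only [Finset.mem_filter, Finset.mem_univ, true_and, Finset.mem_insert, Prod.mk.injEq]
      by_cases hl : l = c
      · subst hl
        rw [hhead b, or_iff_left (hnot b), and_iff_right rfl]
      · rw [enclosesNext_adjacent hX hcs hl]
        simp [hl]
    rw [hins, Finset.prod_insert, closeFactor]
    exact fun hm => hnot m (Finset.mem_filter.1 hm).2

open Classical in
/-- A labelled word contributes if and only if it describes a non-crossing pairing, and then it
contributes the weights of all nested neighboring blocks. -/
theorem run_eq [Fintype α] (wt : α → α → ℝ≥0∞) (cs L : List α) (U : Finset α) (hL : L.Nodup)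
    (hd : Disjoint L.toFinset U) :
    run wt cs L U = if Completes cs L U then nestingWeight wt (L.reverse ++ cs) else 0 := by
  induction cs generalizing L U with
  | nil =>
    rw [run]
    by_cases h : L = [] ∧ U = ∅
    · obtain ⟨rfl, rfl⟩ := h
      rw [if_pos (by simp), if_pos ⟨by simp, by simp [CrossingFree]⟩]
      exact (nestingWeight_nil wt).symm
    · rw [if_neg h, if_neg]
      rintro ⟨h1, -⟩
      refine h ⟨List.eq_nil_iff_forall_not_mem.2 fun l hl => ?_,
        Finset.eq_empty_of_forall_notMem fun l hl => ?_⟩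
      · have := h1 l
        simp [hl] at this
      · have := h1 l
        rw [if_pos hl] at this
        split_ifs at this <;> simp at this
  | cons c cs ih =>
    -- The word `L.reverse ++ cs` is unchanged by an opening and loses two adjacent equal letters
    -- by a closing.
    by_cases hc : c ∈ U
    · have hcL : c ∉ L := fun h => Finset.disjoint_left.1 hd (List.mem_toFinset.2 h) hc
      have h1 : run wt (c :: cs) L U = run wt cs (c :: L) (U.erase c) := by
        cases L <;> simp [run, hc]
      have hd' : Disjoint (c :: L).toFinset (U.erase c) := by
        rw [List.toFinset_cons, Finset.disjoint_insert_left]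
        exact ⟨Finset.notMem_erase _ _, hd.mono_right (Finset.erase_subset _ _)⟩
      rw [h1, ih _ _ (List.nodup_cons.2 ⟨hcL, hL⟩) hd', completes_open hd hc]
      simp
    · cases L with
      | nil =>
        rw [run, if_neg hc, if_neg]
        rintro ⟨h1, -⟩
        have := h1 c
        simp [hc] at this
      | cons l L =>
        rw [run, if_neg hc]
        by_cases hcl : c = l
        · subst hcl
          obtain ⟨hcL, hL'⟩ := List.nodup_cons.1 hL
          have hd' : Disjoint L.toFinset U := by
            rw [List.toFinset_cons, Finset.disjoint_insert_left] at hd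
            exact hd.2
          rw [if_pos rfl, ih L U hL' hd']
          by_cases h : Completes (c :: cs) (c :: L) U
          · rw [if_pos h, if_pos ((completes_close hcL hc).1 h), nestingWeight_close wt hL hc h]
          · rw [if_neg h, if_neg (mt (completes_close hcL hc).2 h), mul_zero]
        · rw [if_neg hcl, if_neg]
          rintro ⟨h1, h2⟩
          -- A letter of a deeper open block would cross the block at the top of the stack.
          have hcL : c ∈ L := by
            by_contra hcL
            have := h1 c
            simp [hcL, hc, hcl] at this
          have hl : l ∈ cs := by
            have := h1 l
            rw [List.count_cons_of_ne hcl, if_pos List.mem_cons_self] at this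
            exact List.count_pos_iff.1 (by omega)
          refine h2 c l hcl ?_
          rw [List.reverse_cons, List.append_assoc]
          have h3 : [c].Sublist L.reverse := List.singleton_sublist.2 (by simpa using hcL)
          have h4 : [l].Sublist cs := List.singleton_sublist.2 hl
          exact h3.append ((h4.cons_cons c).cons_cons l)

end Words

/-! ### Reduction to increasing configurations -/

section Expansion

variable {k : ℕ}

/-- The weights between the points of a configuration `t`. -/
def pointWeight (p q : ℝ) (t : Fin k → ℝ) (l m : Fin k) : ℝ≥0∞ :=
  ENNReal.ofReal (weight p q (t l) (t m))

theorem ofReal_closeWeight (p q : ℝ) (t : Fin k → ℝ) (l : Fin k) (L : List (Fin k)) :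
    ENNReal.ofReal (closeWeight p q t l L) = closeFactor (pointWeight p q t) l L := by
  cases L with
  | nil => exact ENNReal.ofReal_one
  | cons m L => rfl

/-- The stack recursion expanded as a sum over the labellings of all letters. -/
theorem labelled_ofFn (p q : ℝ) (t : Fin k → ℝ) {n : ℕ} (f : Fin n → Profile) (L : List (Fin k))
    (U : Finset (Fin k)) (hd : Disjoint L.toFinset U) :
    labelled p q (List.ofFn f) L U t = ∑ c : Fin n → Fin k,
      (∏ a, ((f a).fn (t (c a)) : ℝ≥0∞)) * run (pointWeight p q t) (List.ofFn c) L U := by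
  induction n generalizing L U with
  | zero => simp [labelled, run]
  | succ n ih =>
    rw [← (Fin.consEquiv fun _ : Fin (n + 1) => Fin k).sum_comp, Fintype.sum_prod_type,
      List.ofFn_succ]
    simp only [Fin.consEquiv, Equiv.coe_fn_mk, List.ofFn_succ, Fin.prod_univ_succ, Fin.cons_zero,
      Fin.cons_succ]
    have hopen (l : Fin k) (hl : l ∈ U) : labelled p q (List.ofFn fun i => f i.succ) (l :: L)
        (U.erase l) t = ∑ c : Fin n → Fin k, (∏ a, ((f a.succ).fn (t (c a)) : ℝ≥0∞)) *
          run (pointWeight p q t) (List.ofFn c) (l :: L) (U.erase l) := by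
      refine ih (fun i => f i.succ) _ _ ?_
      rw [List.toFinset_cons, Finset.disjoint_insert_left]
      exact ⟨Finset.notMem_erase _ _, hd.mono_right (Finset.erase_subset _ _)⟩
    cases L with
    | nil =>
      rw [labelled, ← Finset.sum_filter_add_sum_filter_not Finset.univ (· ∈ U)]
      rw [Finset.sum_congr (s₁ := Finset.univ.filter fun x => x ∉ U) rfl
        (g := fun _ => (0 : ℝ≥0∞)), Finset.sum_const_zero, add_zero, Finset.filter_univ_mem]
      · refine Finset.sum_congr rfl fun l hl => ?_
        rw [hopen l hl, Finset.mul_sum]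
        refine Finset.sum_congr rfl fun c _ => ?_
        rw [run, if_pos hl, mul_assoc]
      · intro l hl
        refine Finset.sum_eq_zero fun c _ => ?_
        rw [run, if_neg (Finset.mem_filter.1 hl).2, mul_zero]
    | cons m L =>
      rw [List.toFinset_cons, Finset.disjoint_insert_left] at hd
      rw [labelled, ← Finset.sum_filter_add_sum_filter_not Finset.univ (· ∈ U)]
      congr 1
      · rw [Finset.filter_univ_mem]
        refine Finset.sum_congr rfl fun l hl => ?_
        rw [hopen l hl, Finset.mul_sum]
        refine Finset.sum_congr rfl fun c _ => ?_
        rw [run, if_pos hl, mul_assoc]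
      · rw [Finset.sum_eq_single m]
        · rw [ih (fun i => f i.succ) L U hd.2, Finset.mul_sum]
          refine Finset.sum_congr rfl fun c _ => ?_
          rw [run, if_neg hd.1, if_pos rfl, ofReal_closeWeight]
          ring
        · intro l hl hlm
          refine Finset.sum_eq_zero fun c _ => ?_
          rw [run, if_neg (Finset.mem_filter.1 hl).2, if_neg hlm, mul_zero]
        · intro h
          simp [hd.1] at h

/-- Permuting the coordinates amounts to renaming the labels. -/
theorem labelled_comp_perm (p q : ℝ) (σ : Equiv.Perm (Fin k)) (t : Fin k → ℝ) (w : List Profile)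
    (L : List (Fin k)) (U : Finset (Fin k)) :
    labelled p q w L U (t ∘ σ) = labelled p q w (L.map σ) (U.image σ) t := by
  induction w generalizing L U with
  | nil => simp [labelled]
  | cons f w ih =>
    have hsum (L : List (Fin k)) :
        ∑ m ∈ U, (f.fn ((t ∘ σ) m) : ℝ≥0∞) * labelled p q w (m :: L) (U.erase m) (t ∘ σ) =
        ∑ m ∈ U.image σ, (f.fn (t m) : ℝ≥0∞) *
          labelled p q w (m :: L.map σ) ((U.image σ).erase m) t := by
      rw [Finset.sum_image σ.injective.injOn]
      refine Finset.sum_congr rfl fun m _ => ?_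
      rw [ih, Finset.image_erase σ.injective]
      rfl
    cases L with
    | nil => exact hsum []
    | cons l L =>
      rw [List.map_cons, labelled, labelled, hsum, ih, List.map_cons]
      congr 3
      cases L <;> rfl

end Expansion

section Order

variable {k : ℕ}

theorem measurePreserving_comp_perm (σ : Equiv.Perm (Fin k)) :
    MeasurePreserving (fun t : Fin k → ℝ => t ∘ σ) (orthant k) (orthant k) := by
  have h := measurePreserving_piCongrLeft (α := fun _ : Fin k => ℝ) (fun _ => halfLine) σ⁻¹
  have h1 : (fun t : Fin k → ℝ => t ∘ σ) =
      MeasurableEquiv.piCongrLeft (fun _ : Fin k => ℝ) σ⁻¹ := by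
    ext t i
    have h2 := Equiv.piCongrLeft_apply_apply (fun _ : Fin k => ℝ) σ⁻¹ t (σ i)
    have h3 : σ⁻¹ (σ i) = i := σ.symm_apply_apply i
    rw [h3] at h2
    exact h2.symm
  rw [h1]
  exact h

theorem orthant_absolutelyContinuous (k : ℕ) : orthant k ≪ volume := by
  unfold orthant halfLine
  rw [← Measure.restrict_pi_pi]
  exact Measure.absolutelyContinuous_of_le Measure.restrict_le_self

theorem ae_injective : ∀ᵐ t ∂orthant k, Function.Injective t := by
  refine (orthant_absolutelyContinuous k).ae_le ?_
  have h : ∀ i j : Fin k, i ≠ j → ∀ᵐ t : Fin k → ℝ, t i ≠ t j := by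
    intro i j hij
    have := Measure.addHaar_submodule (volume : Measure (Fin k → ℝ))
      (LinearMap.ker (LinearMap.proj (R := ℝ) (φ := fun _ : Fin k => ℝ) i - LinearMap.proj j)) ?_
    · rw [ae_iff]
      convert this using 2
      ext t
      simp [sub_eq_zero]
    · intro htop
      have h1 : (Pi.single i 1 : Fin k → ℝ) ∈ LinearMap.ker
          (LinearMap.proj (R := ℝ) (φ := fun _ : Fin k => ℝ) i - LinearMap.proj j) := by
        rw [htop]; trivial
      simp [hij.symm] at h1
  have h2 : ∀ᵐ t : Fin k → ℝ, ∀ i j, i ≠ j → t i ≠ t j := by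
    simp only [Filter.eventually_all]
    exact h
  filter_upwards [h2] with t ht i j hij
  by_contra hne
  exact ht i j hne hij

theorem ae_pos : ∀ᵐ t ∂orthant k, ∀ i, 0 < t i := by
  have h : ∀ᵐ s ∂halfLine, 0 < s := by
    rw [halfLine, ← restrict_Ioi_eq_restrict_Ici]
    exact ae_restrict_mem measurableSet_Ioi
  rw [Filter.eventually_all]
  exact fun i => (Measure.quasiMeasurePreserving_eval (fun _ => halfLine) i).ae h

theorem measurableSet_strictMono : MeasurableSet {t : Fin k → ℝ | StrictMono t} := by
  have : {t : Fin k → ℝ | StrictMono t} = ⋂ i, ⋂ j, ⋂ _ : i < j, {t | t i < t j} := by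
    ext t
    simp [StrictMono]
  rw [this]
  exact MeasurableSet.iInter fun i => MeasurableSet.iInter fun j => MeasurableSet.iInter fun _ =>
    measurableSet_lt (measurable_pi_apply i) (measurable_pi_apply j)

/-- Almost every point of the orthant is brought into increasing order by exactly one permutation
of its coordinates. -/
theorem lintegral_orthant_eq_sum_perm {g : (Fin k → ℝ) → ℝ≥0∞} (hg : Measurable g) :
    ∫⁻ t, g t ∂orthant k =
      ∑ σ : Equiv.Perm (Fin k), ∫⁻ t in {t | StrictMono t}, g (t ∘ σ) ∂orthant k := by
  have hcomp (σ : Equiv.Perm (Fin k)) : Measurable fun t : Fin k → ℝ => t ∘ σ :=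
    (measurePreserving_comp_perm σ).measurable
  have h1 : ∀ᵐ t ∂orthant k, g t = ∑ σ : Equiv.Perm (Fin k),
      {t | StrictMono t}.indicator (fun s => g (s ∘ ⇑σ⁻¹)) (t ∘ σ) := by
    filter_upwards [ae_injective] with t ht
    rw [Finset.sum_eq_single (Tuple.sort t)]
    · rw [Set.indicator_of_mem]
      · congr 1
        ext i
        simp
      · exact (Tuple.monotone_sort t).strictMono_of_injective
          (ht.comp (Tuple.sort t).injective)
    · intro σ _ hσ
      refine Set.indicator_of_notMem (fun h => hσ ?_) _
      have h2 := Tuple.unique_monotone (StrictMono.monotone h) (Tuple.monotone_sort t)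
      ext i
      rw [ht (congrFun h2 i)]
    · simp
  rw [lintegral_congr_ae h1, lintegral_finsetSum]
  · rw [← Equiv.sum_comp (Equiv.inv (Equiv.Perm (Fin k)))]
    refine Finset.sum_congr rfl fun σ _ => ?_
    have h2 := (measurePreserving_comp_perm σ⁻¹).lintegral_comp
      (f := {t | StrictMono t}.indicator fun s => g (s ∘ σ))
      ((hg.comp (hcomp _)).indicator measurableSet_strictMono)
    rw [lintegral_indicator measurableSet_strictMono] at h2
    simpa using h2
  · exact fun σ _ => ((hg.comp (hcomp _)).indicator measurableSet_strictMono).comp (hcomp σ)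

/-- The pairing with the vacuum as an integral over increasing configurations: the factor
`1 / k!` is absorbed by the symmetry of the labels. -/
theorem pairing_nil_eq_lintegral {p q : ℝ} (hp : 0 ≤ p) (hq : 0 ≤ q) {w : List Profile}
    (hw : w.length = 2 * k) :
    (pairing p q hp hq w [] : ℝ≥0∞) = ∫⁻ t in {t : Fin k → ℝ | StrictMono t},
      labelled p q w [] Finset.univ t ∂orthant k := by
  have h1 := factorial_mul_pairing hp hq w [] [] (Finset.univ : Finset (Fin k)) 0 List.nodup_nil
    (by simp) rfl (by simp [hw])
  have h2 : (fun t : Fin k → ℝ => stackProd [] [] t * labelled p q w [] Finset.univ t) =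
      labelled p q w [] Finset.univ := by
    ext t
    simp [stackProd]
  rw [h2, List.toFinset_nil, Finset.empty_union, lmarginal_univ] at h1
  have h3 := lintegral_orthant_eq_sum_perm
    (measurable_labelled p q w [] (Finset.univ : Finset (Fin k)))
  simp only [labelled_comp_perm, List.map_nil, Finset.image_univ_equiv] at h3
  rw [Finset.sum_const, Finset.card_univ, Fintype.card_perm, Fintype.card_fin, nsmul_eq_mul] at h3
  rw [Finset.card_univ, Fintype.card_fin] at h1
  have h4 := h1.trans h3
  rwa [ENNReal.mul_right_inj (by exact_mod_cast k.factorial_ne_zero)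
    (ENNReal.natCast_ne_top _)] at h4

open Classical in
/-- For a configuration with increasing positive coordinates the weight only depends on the order
of the labels. -/
theorem nestingWeight_pointWeight {p q : ℝ} (hp : 0 ≤ p) (hq : 0 ≤ q) (t : Fin k → ℝ)
    (ht : StrictMono t) (hpos : ∀ i, 0 < t i) (W : List (Fin k)) (hW : ∀ l, ¬ Encloses W l l) :
    nestingWeight (pointWeight p q t) W =
      ENNReal.ofReal (p ^ (Finset.univ.filter fun x : Fin k × Fin k =>
          x.1 < x.2 ∧ EnclosesNext W x.2 x.1).card *
        q ^ (Finset.univ.filter fun x : Fin k × Fin k =>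
          x.1 < x.2 ∧ EnclosesNext W x.1 x.2).card) := by
  have h1 : ∀ x ∈ Finset.univ.filter fun x : Fin k × Fin k => EnclosesNext W x.2 x.1,
      pointWeight p q t x.1 x.2 =
        if x.1 < x.2 then ENNReal.ofReal p else ENNReal.ofReal q := by
    intro x hx
    rw [pointWeight, weight]
    rcases lt_trichotomy x.1 x.2 with h | h | h
    · rw [if_pos ⟨hpos _, ht h⟩, if_pos h]
    · exact absurd (h ▸ (Finset.mem_filter.1 hx).2).1 (hW _)
    · rw [if_neg fun h' => (h'.2.trans (ht h)).false, if_pos ⟨hpos _, ht h⟩, if_neg h.asymm]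
  rw [nestingWeight, Finset.prod_congr rfl h1, Finset.prod_ite, Finset.prod_const,
    Finset.prod_const, ENNReal.ofReal_mul (pow_nonneg hp _), ENNReal.ofReal_pow hp,
    ENNReal.ofReal_pow hq, Finset.filter_filter, Finset.filter_filter]
  congr 2
  · congr 1
    refine Finset.filter_congr fun x _ => and_comm
  · refine Finset.card_bij' (fun x _ => x.swap) (fun x _ => x.swap) ?_ ?_ ?_ ?_
    · intro x hx
      simp only [Finset.mem_filter, Finset.mem_univ, true_and, not_lt, Prod.fst_swap,
        Prod.snd_swap] at hx ⊢
      refine ⟨lt_of_le_of_ne hx.2 fun h => hW x.1 ?_, hx.1⟩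
      have := hx.1.1
      rwa [h] at this
    · intro x hx
      simp only [Finset.mem_filter, Finset.mem_univ, true_and, not_lt, Prod.fst_swap,
        Prod.snd_swap] at hx ⊢
      exact ⟨hx.2, hx.1.le⟩
    · simp
    · simp
end Order

/-! ### Labellings and ordered pair partitions -/

section Blocks

variable {n k : ℕ}

theorem quadruple_sublist_ofFn {α : Type*} (c : Fin n → α) (x y z w : α) :
    [x, y, z, w].Sublist (List.ofFn c) ↔ ∃ a₁ a₂ a₃ a₄, a₁ < a₂ ∧ a₂ < a₃ ∧ a₃ < a₄ ∧
      c a₁ = x ∧ c a₂ = y ∧ c a₃ = z ∧ c a₄ = w := by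
  rw [List.sublist_iff_exists_fin_orderEmbedding_get_eq]
  constructor
  · rintro ⟨f, hf⟩
    have h (i : Fin 4) : c ((f i).cast (by simp)) = [x, y, z, w].get i := by
      rw [hf i, List.get_ofFn]
    have hlt {i j : Fin 4} (hij : i < j) : (f i).cast (List.length_ofFn (f := c)) <
      (f j).cast (List.length_ofFn (f := c)) := f.strictMono hij
    exact ⟨_, _, _, _, hlt (i := 0) (j := 1) (by decide), hlt (i := 1) (j := 2) (by decide),
      hlt (i := 2) (j := 3) (by decide), h 0, h 1, h 2, h 3⟩
  · rintro ⟨a₁, a₂, a₃, a₄, h1, h2, h3, rfl, rfl, rfl, rfl⟩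
    have hg : StrictMono (![a₁, a₂, a₃, a₄] : Fin 4 → Fin n) := by
      rw [Fin.strictMono_iff_lt_succ]
      intro i
      fin_cases i <;> simpa
    refine ⟨OrderEmbedding.ofStrictMono
      (fun i : Fin 4 => (![a₁, a₂, a₃, a₄] i).cast (List.length_ofFn (f := c)).symm)
      (fun i j hij => hg hij), fun i => ?_⟩
    rw [List.get_ofFn]
    change Fin 4 at i
    fin_cases i <;> rfl

theorem count_ofFn (c : Fin n → Fin k) (l : Fin k) :
    (List.ofFn c).count l = (Finset.univ.filter fun a => c a = l).card := by
  induction n with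
  | zero => simp
  | succ n ih =>
    rw [List.ofFn_succ, List.count_cons, ih, Fin.card_filter_univ_succ]
    by_cases h : c 0 = l <;> simp [h, add_comm]

/-- The blocks of a labelling of the positions. -/
def blocks (c : Fin n → Fin k) (l : Fin k) : Finset (Fin n) := Finset.univ.filter fun a => c a = l

theorem mem_blocks {c : Fin n → Fin k} {l : Fin k} {a : Fin n} : a ∈ blocks c l ↔ c a = l := by
  simp [blocks]

theorem blocks_injective :
    Function.Injective (blocks : (Fin n → Fin k) → Fin k → Finset (Fin n)) :=
  fun c _ h => funext fun a => (mem_blocks.1 (congrFun h (c a) ▸ mem_blocks.2 rfl)).symm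

theorem exists_blocks_eq {P : Fin k → Finset (Fin n)} (hP : IsOrderedPartition P) :
    ∃ c, blocks c = P := by
  choose c hc using hP.2.2
  refine ⟨c, funext fun l => Finset.ext fun a => mem_blocks.trans ⟨fun h => h ▸ hc a, fun h => ?_⟩⟩
  by_contra hne
  exact Finset.disjoint_left.1 (hP.2.1 _ _ hne) (hc a) h

theorem isNonCrossing_blocks (c : Fin n → Fin k) :
    IsNonCrossing (blocks c) ↔ CrossingFree (List.ofFn c) := by
  refine forall₂_congr fun i j => forall_congr' fun _ => not_congr ?_
  rw [quadruple_sublist_ofFn]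
  simp only [mem_blocks]
  constructor
  · rintro ⟨a, ha, a', ha', b, hb, b', hb', h1, h2, h3⟩
    exact ⟨a, b, a', b', h1, h2, h3, ha, hb, ha', hb'⟩
  · rintro ⟨a, b, a', b', h1, h2, h3, ha, hb, ha', hb'⟩
    exact ⟨a, ha, a', ha', b, hb, b', hb', h1, h2, h3⟩

/-- The labellings that survive the stack recursion are the ordered non-crossing pair partitions. -/
theorem completes_iff (c : Fin n → Fin k) :
    Completes (List.ofFn c) [] Finset.univ ↔
      IsOrderedPartition (blocks c) ∧ IsPair (blocks c) ∧ IsNonCrossing (blocks c) := by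
  rw [Completes, isNonCrossing_blocks]
  simp only [List.not_mem_nil, if_false, Finset.mem_univ, if_true, List.reverse_nil,
    List.nil_append, count_ofFn]
  constructor
  · rintro ⟨h1, h2⟩
    refine ⟨⟨fun l => Finset.card_pos.1 ?_, fun i j hij => Finset.disjoint_left.2 fun a ha hb => ?_,
      fun a => ⟨c a, mem_blocks.2 rfl⟩⟩, h1, h2⟩
    · rw [blocks, h1 l]; exact two_pos
    · exact hij ((mem_blocks.1 ha).symm.trans (mem_blocks.1 hb))
  · exact fun h => h.2

/-- For `Encloses` two positions of the inner block suffice, since a block has no others. -/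
theorem isOuter_blocks {c : Fin n → Fin k} (hc : IsPair (blocks c)) (j i : Fin k) :
    IsOuter (blocks c) j i ↔ Encloses (List.ofFn c) j i := by
  rw [Encloses, quadruple_sublist_ofFn]
  constructor
  · rintro ⟨-, a, ha, b, hb, h⟩
    obtain ⟨x, y, hxy, hi⟩ := Finset.card_eq_two.1 (hc i)
    have hx : x ∈ blocks c i := by simp [hi]
    have hy : y ∈ blocks c i := by simp [hi]
    simp only [mem_blocks] at ha hb
    rcases lt_or_gt_of_ne hxy with hlt | hlt
    · exact ⟨a, x, y, b, (h x hx).1, hlt, (h y hy).2, ha, mem_blocks.1 hx, mem_blocks.1 hy, hb⟩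
    · exact ⟨a, y, x, b, (h y hy).1, hlt, (h x hx).2, ha, mem_blocks.1 hy, mem_blocks.1 hx, hb⟩
  · rintro ⟨a, x, y, b, h1, h2, h3, ha, hx, hy, hb⟩
    have hi : {x, y} = blocks c i := Finset.eq_of_subset_of_card_le
      (by simp [Finset.insert_subset_iff, mem_blocks, hx, hy])
      (by rw [hc i, Finset.card_pair h2.ne])
    refine ⟨?_, a, mem_blocks.2 ha, b, mem_blocks.2 hb, fun z hz => ?_⟩
    · rintro rfl
      have : a ∈ ({x, y} : Finset (Fin n)) := hi ▸ mem_blocks.2 ha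
      rcases Finset.mem_insert.1 this with h | h
      · exact h1.ne h
      · exact (h1.trans h2).ne (Finset.mem_singleton.1 h)
    · rw [← hi, Finset.mem_insert, Finset.mem_singleton] at hz
      rcases hz with rfl | rfl
      · exact ⟨h1, h2.trans h3⟩
      · exact ⟨h1.trans h2, h3⟩

theorem isNeighborOuter_blocks {c : Fin n → Fin k} (hc : IsPair (blocks c)) (j i : Fin k) :
    IsNeighborOuter (blocks c) j i ↔ EnclosesNext (List.ofFn c) j i := by
  simp only [IsNeighborOuter, EnclosesNext, isOuter_blocks hc]

theorem nestingWeight_ofFn {p q : ℝ} (hp : 0 ≤ p) (hq : 0 ≤ q) {c : Fin n → Fin k}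
    (hc : IsPair (blocks c)) {t : Fin k → ℝ} (ht : StrictMono t) (hpos : ∀ i, 0 < t i) :
    nestingWeight (pointWeight p q t) (List.ofFn c) =
      ENNReal.ofReal (partitionWeight p q (blocks c)) := by
  rw [nestingWeight_pointWeight hp hq t ht hpos]
  · rw [partitionWeight, disorders, orders]
    congr 4 <;> (ext x; simp [isNeighborOuter_blocks hc])
  · intro l hl
    exact ((isOuter_blocks hc l l).2 hl).1 rfl

end Blocks

/-! ### Volumes of increasing configurations in boxes -/

section Volume

variable {n k : ℕ}

theorem Interval.eq_of_lo_eq {I J : Interval} (h : I = J ∨ I.Apart J) (hlo : I.lo = J.lo) :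
    I = J := by
  refine h.resolve_right ?_
  have := I.lo_lt_hi
  have := J.lo_lt_hi
  rintro (h | h) <;> simp only [Interval.Before] at h <;> linarith

theorem halfLine_Icc (I : Interval) :
    halfLine (Set.Icc I.lo I.hi) = ENNReal.ofReal I.length := by
  rw [halfLine, Measure.restrict_apply measurableSet_Icc, Set.inter_eq_left.2,
    Real.volume_Icc, Interval.length]
  exact fun x hx => I.lo_nonneg.trans hx.1

/-- The box of all configurations with `t_l ∈ J_l`. -/
def box (J : Fin k → Interval) : Set (Fin k → ℝ) := Set.univ.pi fun l => Set.Icc (J l).lo (J l).hi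

theorem mem_box {J : Fin k → Interval} {t : Fin k → ℝ} :
    t ∈ box J ↔ ∀ l, t l ∈ Set.Icc (J l).lo (J l).hi :=
  Set.mem_univ_pi

theorem measurableSet_box (J : Fin k → Interval) : MeasurableSet (box J) :=
  MeasurableSet.univ_pi fun _ => measurableSet_Icc

/-- An increasing configuration only lies in boxes whose sides are ordered. -/
theorem beforeOrEq_of_mem_box {J : Fin k → Interval} {t : Fin k → ℝ} (ht : StrictMono t)
    (hJ : ∀ l m, J l = J m ∨ (J l).Apart (J m)) (hbox : t ∈ box J) {l m : Fin k} (hlm : l < m) :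
    (J l).BeforeOrEq (J m) := by
  rcases hJ l m with h | h | h
  · exact Or.inr h
  · exact Or.inl h
  · rw [mem_box] at hbox
    have h1 := (hbox l).1
    have h2 := (hbox m).2
    have h3 := ht hlm
    simp only [Interval.Before] at h
    linarith

theorem Interval.BeforeOrEq.lo_le {I J : Interval} (h : I.BeforeOrEq J) : I.lo ≤ J.lo := by
  rcases h with h | rfl
  · exact I.lo_lt_hi.le.trans h
  · exact le_rfl

/-- The permutations that bring an increasing configuration into a box with ordered sides are
those that preserve the sides. -/
theorem comp_perm_mem_box_iff {J : Fin k → Interval} {t : Fin k → ℝ} (ht : StrictMono t)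
    (hJ : ∀ l m, J l = J m ∨ (J l).Apart (J m)) (hmono : ∀ l m, l < m → (J l).BeforeOrEq (J m))
    (σ : Equiv.Perm (Fin k)) : t ∘ σ ∈ box J ↔ J ∘ σ = J ∧ t ∈ box J := by
  have h0 : t ∘ σ ∈ box J ↔ t ∈ box (J ∘ σ.symm) := by
    rw [mem_box, mem_box, ← σ.forall_congr_right (q := fun l =>
      t l ∈ Set.Icc ((J ∘ σ.symm) l).lo ((J ∘ σ.symm) l).hi)]
    simp
  have h1 : J ∘ σ = J ↔ J ∘ σ.symm = J := by
    rw [Equiv.comp_symm_eq, eq_comm]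
  rw [h0, h1]
  constructor
  · intro h
    have hmo {J : Fin k → Interval} (hJ : ∀ l m, l < m → (J l).BeforeOrEq (J m)) :
        Monotone fun l => (J l).lo := fun l m hlm => by
      rcases hlm.eq_or_lt with rfl | hlm
      · exact le_rfl
      · exact (hJ l m hlm).lo_le
    have h2 := hmo fun l m hlm => beforeOrEq_of_mem_box ht (fun l m => hJ _ _) h hlm
    have h3 : (fun l => (J l).lo) ∘ σ.symm = (fun l => (J l).lo) ∘ (1 : Equiv.Perm (Fin k)) :=
      Tuple.unique_monotone h2 (hmo hmono)
    have h4 : J ∘ σ.symm = J := funext fun l => Interval.eq_of_lo_eq (hJ _ _) (congrFun h3 l)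
    exact ⟨h4, h4 ▸ h⟩
  · rintro ⟨h, h'⟩
    rwa [h]

open Classical in
theorem volume_box_strictMono {J : Fin k → Interval}
    (hJ : ∀ l m, J l = J m ∨ (J l).Apart (J m)) (hmono : ∀ l m, l < m → (J l).BeforeOrEq (J m)) :
    orthant k ({t | StrictMono t} ∩ box J) =
      ENNReal.ofReal (∏ K ∈ Finset.univ.image J,
        K.length ^ (Finset.univ.filter fun l => J l = K).card /
          ((Finset.univ.filter fun l => J l = K).card.factorial : ℝ)) := by
  have hpos (K : Interval) : 0 ≤ K.length := sub_nonneg.2 K.lo_lt_hi.le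
  have h1 : orthant k (box J) = ENNReal.ofReal (∏ l, (J l).length) := by
    rw [orthant, box, Measure.pi_pi, ENNReal.ofReal_prod_of_nonneg fun l _ => hpos _]
    exact Finset.prod_congr rfl fun l _ => halfLine_Icc _
  have h2 := lintegral_orthant_eq_sum_perm (g := (box J).indicator 1)
    (measurable_one.indicator (measurableSet_box J))
  rw [lintegral_indicator_one (measurableSet_box J), h1] at h2
  -- Each permutation that preserves the sides contributes the volume in question, all others
  -- contribute nothing.
  have h3 (σ : Equiv.Perm (Fin k)) :
      ∫⁻ t in {t | StrictMono t}, (box J).indicator 1 (t ∘ σ) ∂orthant k =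
        if J ∘ σ = J then orthant k ({t | StrictMono t} ∩ box J) else 0 := by
    have h4 : ∫⁻ t in {t | StrictMono t}, (box J).indicator 1 (t ∘ σ) ∂orthant k =
        ∫⁻ t in {t | StrictMono t}, if J ∘ σ = J then (box J).indicator 1 t else 0 ∂orthant k := by
      refine setLIntegral_congr_fun measurableSet_strictMono fun t ht => ?_
      have h5 := comp_perm_mem_box_iff ht hJ hmono σ
      by_cases hσ : J ∘ σ = J
      · simp only [hσ, true_and, if_true] at h5 ⊢
        by_cases hb : t ∈ box J <;> simp [hb, h5]
      · simp only [hσ, false_and, iff_false, if_false] at h5 ⊢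
        simp [h5]
    rw [h4]
    split_ifs
    · rw [lintegral_indicator_one (measurableSet_box J), Measure.restrict_apply
        (measurableSet_box J), Set.inter_comm]
    · simp
  rw [Finset.sum_congr rfl fun σ _ => h3 σ, ← Finset.sum_filter, Finset.sum_const, nsmul_eq_mul,
    ← Fintype.card_subtype, DomMulAct.stabilizer_card'] at h2
  simp only [Fintype.card_subtype] at h2
  rw [Finset.prod_div_distrib, ← Finset.prod_comp (fun K => K.length) J, ← Nat.cast_prod,
    ENNReal.ofReal_div_of_pos, ENNReal.ofReal_natCast, h2, mul_comm,
    ENNReal.mul_div_cancel_right]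
  · exact_mod_cast (Finset.prod_pos fun K _ => Nat.factorial_pos _).ne'
  · exact ENNReal.natCast_ne_top _
  · exact_mod_cast Finset.prod_pos fun K _ => Nat.factorial_pos _

end Volume

/-! ### The moment formula -/

section Moments

variable {n k : ℕ}

/-- The characteristic function of an interval as a profile. -/
def Interval.profile (I : Interval) : Profile where
  fn := (Set.Icc I.lo I.hi).indicator 1
  measurable := measurable_one.indicator measurableSet_Icc
  memLp := by
    have h := memLp_indicator_const (μ := halfLine) 2 (measurableSet_Icc (a := I.lo) (b := I.hi))
      (1 : ℂ) (Or.inr (halfLine_Icc_ne_top I.lo I.hi))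
    convert h using 2 with t
    by_cases ht : t ∈ Set.Icc I.lo I.hi <;> simp [ht]

theorem Interval.toH_profile (I : Interval) : I.profile.toH = I.chi := by
  apply Lp.ext
  filter_upwards [I.profile.toH_coeFn, indicatorConstLp_coeFn (p := 2)
    (hs := measurableSet_Icc (a := I.lo) (b := I.hi)) (hμs := halfLine_Icc_ne_top I.lo I.hi)
    (c := (1 : ℂ))] with t h1 h2
  rw [h1, Interval.chi, PQ.chi, h2, Interval.profile]
  by_cases ht : t ∈ Set.Icc I.lo I.hi <;> simp [ht]

theorem Interval.profile_fn_of_mem {I : Interval} {t : ℝ} (h : t ∈ Set.Icc I.lo I.hi) :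
    I.profile.fn t = 1 := Set.indicator_of_mem h _

theorem Interval.profile_fn_of_notMem {I : Interval} {t : ℝ} (h : t ∉ Set.Icc I.lo I.hi) :
    I.profile.fn t = 0 := Set.indicator_of_notMem h _

theorem vacuumState_gaussian_chi {p q : ℝ} (hp : 0 ≤ p) (hq : 0 ≤ q) (I : Fin n → Interval) :
    vacuumState (List.ofFn fun i => gaussian p q (I i).chi).prod =
      ((pairing p q hp hq (List.ofFn fun i => (I i).profile) [] : ℝ) : ℂ) := by
  rw [← inner_productVector, List.map_ofFn, vacuumState, productVector]
  simp only [Function.comp_def, Interval.toH_profile]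

/-- The configurations for which a given labelling of the letters contributes. -/
def admissible (I : Fin n → Interval) (c : Fin n → Fin k) : Set (Fin k → ℝ) :=
  {t | ∀ a, t (c a) ∈ Set.Icc (I a).lo (I a).hi}

theorem measurableSet_admissible (I : Fin n → Interval) (c : Fin n → Fin k) :
    MeasurableSet (admissible I c) := by
  have : admissible I c = ⋂ a, (fun t => t (c a)) ⁻¹' Set.Icc (I a).lo (I a).hi := by
    ext t
    simp only [admissible, Set.mem_iInter, Set.mem_preimage]
    rfl
  rw [this]
  exact MeasurableSet.iInter fun a => measurable_pi_apply (c a) measurableSet_Icc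

theorem Interval.Apart.exists_eq {I J : Interval} (h : I.Apart J) :
    ∃ x, ∀ t, t ∈ Set.Icc I.lo I.hi → t ∈ Set.Icc J.lo J.hi → t = x := by
  rcases h with h | h <;> simp only [Interval.Before] at h
  · exact ⟨I.hi, fun t h1 h2 => le_antisymm h1.2 (h.trans h2.1)⟩
  · exact ⟨J.hi, fun t h1 h2 => le_antisymm h2.2 (h.trans h1.1)⟩

instance : NullSingletonClass halfLine := by unfold halfLine; infer_instance

theorem isAdapted_blocks_iff {I : Fin n → Interval} {c : Fin n → Fin k} {J : Fin k → Interval}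
    (hJ : ∀ a, I a = J (c a)) (hc : ∀ l, ∃ a, c a = l) :
    IsAdapted (blocks c) I ↔ ∀ l m, l < m → (J l).BeforeOrEq (J m) := by
  simp only [IsAdapted, mem_blocks, hJ]
  constructor
  · intro h l m hlm
    obtain ⟨a, rfl⟩ := hc l
    obtain ⟨b, rfl⟩ := hc m
    exact h.2 _ _ hlm a rfl b rfl
  · refine fun h => ⟨?_, ?_⟩
    · rintro l i rfl j hj
      rw [hj]
    · rintro l m hlm i rfl j rfl
      exact h _ _ hlm

open Classical in
theorem halfCount_eq {I : Fin n → Interval} {c : Fin n → Fin k} {J : Fin k → Interval}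
    (hJ : ∀ a, I a = J (c a)) (hc : IsPair (blocks c)) (K : Interval) :
    halfCount I K = (Finset.univ.filter fun l => J l = K).card := by
  have h : (Finset.univ.filter fun a => I a = K).card =
      2 * (Finset.univ.filter fun l => J l = K).card := by
    rw [Finset.card_eq_sum_card_fiberwise (f := c) (t := Finset.univ.filter fun l => J l = K)]
    · rw [Finset.sum_congr rfl (g := fun _ => 2), Finset.sum_const, smul_eq_mul, mul_comm]
      intro l hl
      rw [← hc l, blocks, Finset.filter_filter]
      congr 1
      refine Finset.filter_congr fun a _ => and_iff_right_of_imp fun ha => ?_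
      rw [hJ, ha]
      exact (Finset.mem_filter.1 hl).2
    · intro a ha
      simpa [hJ] using ha
  rw [halfCount, h, Nat.mul_div_cancel_left _ two_pos]

open Classical in
/-- The volume of the increasing configurations compatible with a given ordered pair partition. -/
theorem volume_admissible {I : Fin n → Interval} (hI : ∀ i j, I i = I j ∨ (I i).Apart (I j))
    {c : Fin n → Fin k} (hpart : IsOrderedPartition (blocks c)) (hpair : IsPair (blocks c)) :
    orthant k ({t | StrictMono t} ∩ admissible I c) = if IsAdapted (blocks c) I then
      ENNReal.ofReal (∏ K ∈ Finset.univ.image I,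
        K.length ^ halfCount I K / ((halfCount I K).factorial : ℝ)) else 0 := by
  have hc : ∀ l, ∃ a, c a = l := fun l => (hpart.1 l).imp fun a ha => mem_blocks.1 ha
  by_cases hconst : ∀ a b, c a = c b → I a = I b
  · choose s hs using hc
    have hJ : ∀ a, I a = (I ∘ s) (c a) := fun a => hconst _ _ (hs (c a)).symm
    have hc : ∀ l, ∃ a, c a = l := fun l => ⟨s l, hs l⟩
    have hbox : admissible I c = box (I ∘ s) := by
      ext t
      rw [mem_box]
      constructor
      · intro h l
        have := h (s l)
        rwa [hs] at this
      · intro h a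
        rw [hJ a]
        exact h (c a)
    have himage : Finset.univ.image I = Finset.univ.image (I ∘ s) := by
      ext K
      simp only [Finset.mem_image, Finset.mem_univ, true_and]
      exact ⟨fun ⟨a, ha⟩ => ⟨c a, (hJ a).symm.trans ha⟩, fun ⟨l, hl⟩ => ⟨s l, hl⟩⟩
    rw [isAdapted_blocks_iff hJ hc, hbox]
    split_ifs with h
    · rw [volume_box_strictMono (J := I ∘ s) (fun l m => hI _ _) h, himage]
      simp only [halfCount_eq hJ hpair]
    · rw [Set.eq_empty_of_forall_notMem (s := {t | StrictMono t} ∩ box (I ∘ s)) fun t ht =>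
        h fun l m hlm => beforeOrEq_of_mem_box ht.1 (fun l m => hI _ _) ht.2 hlm, measure_empty]
  · -- Different intervals have at most one common point, and a coordinate is almost never there.
    push Not at hconst
    obtain ⟨a, b, hab, hne⟩ := hconst
    rw [if_neg fun h => hne (h.1 (c a) a (mem_blocks.2 rfl) b (mem_blocks.2 hab.symm))]
    obtain ⟨x, hx⟩ := ((hI a b).resolve_left hne).exists_eq
    refine measure_mono_null (t := {t : Fin k → ℝ | t (c a) = x}) ?_
      (Measure.pi_hyperplane (fun _ => halfLine) (c a) x)
    exact fun t ht => hx _ (ht.2 a) (hab ▸ ht.2 b)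

open Classical in
/-- The integral over increasing configurations, evaluated labelling by labelling. -/
theorem pairing_eq_sum {p q : ℝ} (hp : 0 ≤ p) (hq : 0 ≤ q) {I : Fin n → Interval}
    (hI : ∀ i j, I i = I j ∨ (I i).Apart (I j)) (hn : n = 2 * k) :
    (pairing p q hp hq (List.ofFn fun i => (I i).profile) [] : ℝ≥0∞) =
      ∑ c : Fin n → Fin k, if (IsOrderedPartition (blocks c) ∧ IsPair (blocks c) ∧
        IsNonCrossing (blocks c)) ∧ IsAdapted (blocks c) I then
          ENNReal.ofReal (partitionWeight p q (blocks c)) *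
            ENNReal.ofReal (∏ K ∈ Finset.univ.image I,
              K.length ^ halfCount I K / ((halfCount I K).factorial : ℝ)) else 0 := by
  have h1 : ∀ᵐ t ∂(orthant k).restrict {t | StrictMono t},
      labelled p q (List.ofFn fun i => (I i).profile) [] Finset.univ t =
        ∑ c : Fin n → Fin k, (admissible I c).indicator (fun _ =>
          if IsOrderedPartition (blocks c) ∧ IsPair (blocks c) ∧ IsNonCrossing (blocks c) then
            ENNReal.ofReal (partitionWeight p q (blocks c)) else 0) t := by
    filter_upwards [ae_restrict_of_ae ae_pos, ae_restrict_mem measurableSet_strictMono]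
      with t hpos ht
    rw [labelled_ofFn _ _ _ _ _ _ (by simp)]
    refine Finset.sum_congr rfl fun c _ => ?_
    rw [run_eq _ _ _ _ List.nodup_nil (by simp), List.reverse_nil, List.nil_append]
    by_cases hadm : t ∈ admissible I c
    · rw [Set.indicator_of_mem hadm, Finset.prod_eq_one fun a _ => by
        rw [Interval.profile_fn_of_mem (hadm a), ENNReal.coe_one], one_mul]
      refine if_ctx_congr (completes_iff c) (fun h => ?_) fun _ => rfl
      exact nestingWeight_ofFn hp hq h.2.1 ht hpos
    · rw [Set.indicator_of_notMem hadm]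
      obtain ⟨a, ha⟩ := not_forall.1 hadm
      rw [Finset.prod_eq_zero (Finset.mem_univ a), zero_mul]
      rw [Interval.profile_fn_of_notMem ha, ENNReal.coe_zero]
  rw [pairing_nil_eq_lintegral (k := k) hp hq (by simpa using hn), lintegral_congr_ae h1,
    lintegral_finsetSum]
  · refine Finset.sum_congr rfl fun c _ => ?_
    rw [lintegral_indicator_const (measurableSet_admissible I c),
      Measure.restrict_apply (measurableSet_admissible I c), Set.inter_comm]
    by_cases h : IsOrderedPartition (blocks c) ∧ IsPair (blocks c) ∧ IsNonCrossing (blocks c)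
    · rw [volume_admissible hI h.1 h.2.1]
      simp only [h, and_self, true_and, if_true, mul_ite, mul_zero]
    · rw [if_neg h, if_neg fun h' => h h'.1, zero_mul]
  · exact fun c _ => measurable_const.indicator (measurableSet_admissible I c)

theorem card_eq_of_isPair {P : Fin k → Finset (Fin n)} (hP : IsOrderedPartition P)
    (hpair : IsPair P) : n = 2 * k := by
  obtain ⟨c, rfl⟩ := exists_blocks_eq hP
  have h := Finset.card_eq_sum_card_fiberwise (f := c) (s := Finset.univ) (t := Finset.univ)
    (fun _ _ => Finset.mem_univ _)
  have h2 : ∀ l, (Finset.univ.filter fun a => c a = l).card = 2 := hpair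
  rw [Finset.sum_congr rfl fun l _ => h2 l] at h
  simpa [mul_comm] using h

theorem partitionWeight_nonneg {p q : ℝ} (hp : 0 ≤ p) (hq : 0 ≤ q) (P : Fin k → Finset (Fin n)) :
    0 ≤ partitionWeight p q P :=
  mul_nonneg (pow_nonneg hp _) (pow_nonneg hq _)

open Classical in
/-- The moment formula for a family of intervals that are pairwise equal or apart. -/
theorem vacuumState_prod_gaussian {p q : ℝ} (hp : 0 ≤ p) (hq : 0 ≤ q) (I : Fin n → Interval)
    (hI : ∀ i j, I i = I j ∨ (I i).Apart (I j)) :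
    vacuumState (List.ofFn fun i => gaussian p q (I i).chi).prod =
      (((∏ J ∈ Finset.univ.image I,
          J.length ^ halfCount I J / ((halfCount I J).factorial : ℝ)) *
        ∑ P ∈ (ONC2 n).filter fun P => IsAdapted P I, partitionWeight p q P : ℝ) : ℂ) := by
  rw [vacuumState_gaussian_chi hp hq]
  congr 1
  by_cases hn : n = 2 * (n / 2)
  · have hD : 0 ≤ ∏ J ∈ Finset.univ.image I,
        J.length ^ halfCount I J / ((halfCount I J).factorial : ℝ) :=
      Finset.prod_nonneg fun J _ =>
        div_nonneg (pow_nonneg (sub_nonneg.2 J.lo_lt_hi.le) _) (Nat.cast_nonneg _)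
    have h := pairing_eq_sum hp hq hI hn
    rw [← Finset.sum_filter, ← Finset.sum_mul,
      ← ENNReal.ofReal_sum_of_nonneg fun c _ => partitionWeight_nonneg hp hq _, mul_comm,
      ← ENNReal.ofReal_mul hD] at h
    rw [← ENNReal.coe_toReal, h, ENNReal.toReal_ofReal (mul_nonneg hD
      (Finset.sum_nonneg fun c _ => partitionWeight_nonneg hp hq _))]
    congr 1
    refine Finset.sum_nbij blocks ?_ blocks_injective.injOn ?_ fun _ _ => rfl
    · intro c hc
      simpa [ONC2] using hc
    · intro P hP
      have hP' : (IsOrderedPartition P ∧ IsPair P ∧ IsNonCrossing P) ∧ IsAdapted P I := by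
        simpa [ONC2] using hP
      obtain ⟨c, rfl⟩ := exists_blocks_eq hP'.1.1
      exact ⟨c, by simpa using hP', rfl⟩
  · rw [pairing_eq_zero hp hq _ _ (Or.inr (by
        simp only [List.length_ofFn, List.length_nil]; omega)),
      Finset.sum_eq_zero, mul_zero, NNReal.coe_zero]
    intro P hP
    have hP' : (IsOrderedPartition P ∧ IsPair P ∧ IsNonCrossing P) ∧ IsAdapted P I := by
      simpa [ONC2] using hP
    exact absurd (card_eq_of_isPair hP'.1.1 hP'.1.2.1) hn

theorem isAdapted_const (P : Fin k → Finset (Fin n)) (J : Interval) :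
    IsAdapted P fun _ => J :=
  ⟨fun _ _ _ _ _ => rfl, fun _ _ _ _ _ _ _ => Or.inr rfl⟩

open Classical in
theorem vacuumState_gaussian_pow {p q : ℝ} (hp : 0 ≤ p) (hq : 0 ≤ q) (n : ℕ) {t : ℝ}
    (ht : 0 < t) :
    vacuumState (gaussian p q (chi 0 t) ^ (2 * n)) =
      ((∑ P ∈ ONC2 (2 * n), partitionWeight p q P * (t ^ n / (n.factorial : ℝ)) : ℝ) : ℂ) := by
  set J : Interval := ⟨0, t, le_rfl, ht⟩
  have h := vacuumState_prod_gaussian hp hq (fun _ : Fin (2 * n) => J) fun _ _ => Or.inl rfl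
  have hcount : halfCount (fun _ : Fin (2 * n) => J) J = n := by
    simp [halfCount]
  have hprod : ∏ K ∈ Finset.univ.image (fun _ : Fin (2 * n) => J),
      K.length ^ halfCount (fun _ : Fin (2 * n) => J) K /
        ((halfCount (fun _ : Fin (2 * n) => J) K).factorial : ℝ) = t ^ n / (n.factorial : ℝ) := by
    rcases Nat.eq_zero_or_pos n with rfl | hn
    · simp
    · have : Nonempty (Fin (2 * n)) := ⟨⟨0, by omega⟩⟩
      rw [Finset.image_const Finset.univ_nonempty, Finset.prod_singleton, hcount]
      simp [J, Interval.length]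
  rw [hprod, List.ofFn_const, List.prod_replicate,
    Finset.filter_true_of_mem fun P _ => isAdapted_const P J, Finset.mul_sum] at h
  simp only [mul_comm (t ^ n / (n.factorial : ℝ))] at h
  exact h

theorem chi_self (s : ℝ) : chi s s = 0 := by
  apply Lp.ext
  have h : ∀ᵐ t ∂halfLine, t ≠ s := by
    simp [ae_iff, measure_singleton]
  filter_upwards [indicatorConstLp_coeFn (p := 2) (hs := measurableSet_Icc (a := s) (b := s))
    (hμs := halfLine_Icc_ne_top s s) (c := (1 : ℂ)), Lp.coeFn_zero ℂ 2 halfLine, h] with t h1 h2 h3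
  rw [chi, h1, h2]
  simp [h3]

theorem gaussian_zero (p q : ℝ) : gaussian p q 0 = 0 := by
  have h : creation p q 0 = 0 := by
    refine ContinuousLinearMap.ext fun F => lp.ext (funext fun n => ?_)
    cases n with
    | zero => exact creation_apply_zero p q 0 F
    | succ n =>
      refine norm_le_zero_iff.1 ((norm_createParticle_le p q 0 (F n)).trans_eq ?_)
      rw [norm_zero, mul_zero, zero_mul]
  rw [gaussian, annihilation, h, map_zero, add_zero]

end Moments

end

end PQ

open Classical in
theorem theorem3p1 (p q : ℝ) (hp : 0 ≤ p) (hq : 0 ≤ q) :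
    (∀ (n : ℕ) (I : Fin n → PQ.Interval), (∀ i j, I i = I j ∨ (I i).Apart (I j)) →
      PQ.vacuumState (List.ofFn fun i => PQ.gaussian p q (I i).chi).prod =
        (((∏ J ∈ Finset.univ.image I,
            J.length ^ PQ.halfCount I J / ((PQ.halfCount I J).factorial : ℝ)) *
          ∑ P ∈ (PQ.ONC2 n).filter fun P => PQ.IsAdapted P I, PQ.partitionWeight p q P : ℝ) : ℂ)) ∧
    (∀ (n : ℕ) (t : ℝ), 0 ≤ t →
      PQ.vacuumState (PQ.gaussian p q (PQ.chi 0 t) ^ (2 * n)) =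
        ((∑ P ∈ PQ.ONC2 (2 * n), PQ.partitionWeight p q P * (t ^ n / (n.factorial : ℝ)) : ℝ) : ℂ)) := by
  refine ⟨fun n I hI => PQ.vacuumState_prod_gaussian hp hq I hI, fun n t ht => ?_⟩
  rcases Nat.eq_zero_or_pos n with rfl | hn
  · simpa using PQ.vacuumState_gaussian_pow hp hq 0 one_pos
  · rcases ht.eq_or_lt with rfl | ht
    · rw [PQ.chi_self, PQ.gaussian_zero, zero_pow (by omega), zero_pow hn.ne']
      simp [PQ.vacuumState]
    · exact PQ.vacuumState_gaussian_pow hp hq n ht
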